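/- Let $v:\mathbb R^2\to S^1$ be a Lipschitz map into the unit circle with least Lipschitz constant $\|v\|_{\mathrm{Lip}}$, and let $0<\delta<1$. A rectangle $R$ is a product $I\times J$ of two bounded nondegenerate intervals with respect to coordinate axes $(e,e^\perp)$, where $e$ is a unit vector and $e^\perp$ is $e$ rotated by $\pi/2$, and where $|I|\ge|J|>0$; write $L(R)=|I|$ and $W(R)=|J|$. Let $EX(R)\subset S^1$ be the arc centered at $e$ of length $W(R)/L(R)$, and put $V(R)=R\cap v^{-1}(EX(R))$. Define $$M_{v,\delta}f(x)=\sup_{R}\ \frac{\mathbf 1_R(x)}{|R|}\int_R|f(y)|\,dy ,$$ where the supremum is over all rectangles $R$ with $L(R)\le(100\|v\|_{\mathrm{Lip}})^{-1}$ (no restriction if $\|v\|_{\mathrm{Lip}}=0$) and $|V(R)|\ge\delta|R|$. Then $M_{v,\delta}$ is bounded from $L^2(\mathbb R^2)$ to $L^{2,\infty}(\mathbb R^2)$ with norm $\lesssim\delta^{-1/2}$. That is, there is an absolute constant $C$, independent of $v$ and $\delta$, such that for every $f\in L^2(\mathbb R^2)$ the function $M_{v,\delta}f$ is Lebesgue measurable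 and, for every $\lambda>0$, $$\bigl|\{x\in\mathbb R^2: M_{v,\delta}f(x)>\lambda\}\bigr|\le C\,\delta^{-1}\lambda^{-2}\|f\|_{L^2(\mathbb R^2)}^2 .$$ -/

import Mathlib

open MeasureTheory
open scoped ENNReal NNReal

noncomputable section

namespace LipKakeya

/-- The Euclidean plane. -/
abbrev Plane : Type := EuclideanSpace ℝ (Fin 2)

/-- The unit circle in the plane. -/
abbrev Circ : Type := Metric.sphere (0 : Plane) 1

/-- The vector `e` rotated by `π / 2` (counterclockwise). -/
def perp (e : Plane) : Plane := !₂[-e 1, e 0]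

/-- A nondegenerate closed rectangle `I × J` in the coordinate axes `(e, perp e)`, where
`I = [a₁, a₂]` and `J = [b₁, b₂]` satisfy `|I| ≥ |J| > 0`. -/
structure Rect where
  e : Circ
  a₁ : ℝ
  a₂ : ℝ
  b₁ : ℝ
  b₂ : ℝ
  width_pos : b₁ < b₂
  width_le_length : b₂ - b₁ ≤ a₂ - a₁

namespace Rect

/-- The length `|I|`. -/
def L (R : Rect) : ℝ := R.a₂ - R.a₁

/-- The width `|J|`. -/
def W (R : Rect) : ℝ := R.b₂ - R.b₁

/-- The set of points of the rectangle. -/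
def toSet (R : Rect) : Set Plane :=
  {x | inner ℝ (R.e : Plane) x ∈ Set.Icc R.a₁ R.a₂ ∧
    inner ℝ (perp (R.e : Plane)) x ∈ Set.Icc R.b₁ R.b₂}

/-- The interval of uncertainty: the closed arc of the unit circle centered at `e`, of arc
length `W / L`. (The unoriented angle between unit vectors is their arc distance.) -/
def EX (R : Rect) : Set Circ :=
  {u | InnerProductGeometry.angle (R.e : Plane) (u : Plane) ≤ (R.W / R.L) / 2}

/-- The part of the rectangle on which the vector field `v` points into the interval of
uncertainty. -/
def V (v : Plane → Circ) (R : Rect) : Set Plane := R.toSet ∩ v ⁻¹' R.EX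

end Rect

/-- The Lipschitz norm of a Lipschitz map: its least Lipschitz constant. -/
def lipNorm (v : Plane → Circ) : ℝ≥0 := sInf {K : ℝ≥0 | LipschitzWith K v}

/-- The rectangles over which the maximal function is formed: `L(R) ≤ (100 ‖v‖_Lip)⁻¹`
(no restriction if `‖v‖_Lip = 0`, as `0⁻¹ = ∞` in `ℝ≥0∞`) and `|V(R)| ≥ δ |R|`. -/
def Admissible (v : Plane → Circ) (δ : ℝ) (R : Rect) : Prop :=
  ENNReal.ofReal R.L ≤ (100 * (lipNorm v : ℝ≥0∞))⁻¹ ∧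
    ENNReal.ofReal δ * volume R.toSet ≤ volume (R.V v)

/-- The maximal function: the supremum over all admissible `R` of
`1_R(x) |R|⁻¹ ∫_R |f|`, with values in `[0, ∞]`. -/
def maximalFn (v : Plane → Circ) (δ : ℝ) (f : Plane → ℂ) (x : Plane) : ℝ≥0∞ :=
  ⨆ (R : Rect) (_ : Admissible v δ R),
    R.toSet.indicator (fun _ => (volume R.toSet)⁻¹ * ∫⁻ y in R.toSet, ‖f y‖ₑ) x

end LipKakeya

end

/-! By Cauchy–Schwarz (`sum_measure_le_of_average`), the weak `L²` bound reduces to a covering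
statement. Given finitely many admissible rectangles with large mean of `|f|`, one selects a
subfamily whose total area controls the area of the whole union, and whose multiplicity function `N`
satisfies `∫ N² ≲ δ⁻¹ ∑ |R|`.

Rectangles pointing into one sector are enclosed in tubes, parallelograms with vertical sides, in a
frame where `v` becomes a slope field `σ`. Tubes are examined by decreasing length, and one is kept
when it has a point free of the tubes kept before, that is, a point where the vertical maximal
function of their dilates is small. Rejected tubes lie where this maximal function is large, so the
one-dimensional weak `(1,1)` bound on vertical lines controls their union (`Tube.volume_iUnion_le`).

For `∫ N²`, consider two kept tubes that meet at an angle `θ` (difference of slopes). If `θ` is at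
most a multiple of the eccentricity `w / ℓ` of the later one, the earlier tube passes close to the
free point of the later one; the widths of all such earlier tubes add up to at most the later width.
If `θ` is large, the overlap is about `w_R w_Q / θ`, and one fixes the earlier, longer tube `Q` and
sums `w_R / θ` over the later `R`. This is where the vector field enters. Since the Lipschitz
constant times the length is small, moving vertically from `R` to the axis of `Q` changes `σ` by a
small fraction of `θ`. Hence on the axis of `Q` the field has nearly the slope of `R` over a set
`U_R` of length at least `2 δ ℓ_R` (`Tube.Transversal.volume_le`). If two such sets meet, the
corresponding angles with `Q` are comparable. A Vitali selection among the `U_R` produces groups of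
comparable angle and nearby crossing point. In each group freeness supplies the density hypothesis
of `sum_mass_le_of_density`, so the sum is at most a multiple of the length of the leader. The
leaders have disjoint `U_R` inside an interval of length comparable to `ℓ_Q`, so their lengths add
up to `≲ δ⁻¹ ℓ_Q`: this is the only source of `δ⁻¹`. -/

namespace LipKakeya

/-! ### Packing, covering and greedy selection. -/

/-- A packing estimate on the line. Masses `a i` sit at points `x i` and carry lengths `ℓ i`,
decreasing in `i`. If around each point, at each scale `r ≥ ℓ i`, the earlier masses of length at
least `r` have density at most one, then an interval longer than one of the lengths it contains
carries mass at most four times its length. -/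
theorem sum_mass_le_of_density {ι : Type*} [LinearOrder ι] (s : Finset ι) (x a ℓ : ι → ℝ)
    (hℓ : ∀ i ∈ s, 0 < ℓ i) (ha : ∀ i ∈ s, 0 ≤ a i) (haℓ : ∀ i ∈ s, a i ≤ ℓ i)
    (hanti : ∀ i ∈ s, ∀ j ∈ s, i ≤ j → ℓ j ≤ ℓ i)
    (hden : ∀ i ∈ s, ∀ r, ℓ i ≤ r →
      ∑ j ∈ s with j < i ∧ |x j - x i| ≤ r ∧ r ≤ ℓ j, a j ≤ r)
    (b h : ℝ) (hshort : ∃ i ∈ s, x i ∈ Set.Icc b (b + h) ∧ ℓ i < h) :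
    ∑ i ∈ s with x i ∈ Set.Icc b (b + h), a i ≤ 4 * h := by
  classical
  obtain ⟨ε, hε, hεℓ⟩ : ∃ ε > 0, ∀ i ∈ s, ε ≤ ℓ i := by
    obtain ⟨i₀, hi₀, -⟩ := hshort
    obtain ⟨i, hi, hmin⟩ := s.exists_min_image ℓ ⟨i₀, hi₀⟩
    exact ⟨ℓ i, hℓ i hi, hmin⟩
  -- Induction on the dyadic size of `h` relative to the smallest length `ε`; at `n = 0` no length
  -- can be below `h`. The claim for each half is mass at most `2 * h`.
  have key : ∀ n : ℕ, ∀ b h : ℝ, h ≤ 2 ^ n * ε →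
      (∃ i ∈ s, x i ∈ Set.Icc b (b + h) ∧ ℓ i < h) →
      ∑ i ∈ s with x i ∈ Set.Icc b (b + h), a i ≤ 4 * h := by
    intro n
    induction n with
    | zero =>
      rintro b h hh ⟨i, hi, -, hlt⟩
      have := hεℓ i hi
      simp only [pow_zero, one_mul] at hh
      linarith
    | succ n ih =>
      rintro b h hh ⟨i₀, hi₀, hx₀, hlt₀⟩
      have hh0 : 0 < h := (hℓ i₀ hi₀).trans hlt₀
      have half : ∀ c, b ≤ c → c + h / 2 ≤ b + h →
          ∑ i ∈ s with x i ∈ Set.Icc c (c + h / 2), a i ≤ 2 * h := by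
        intro c hbc hcb
        by_cases hs : ∃ i ∈ s, x i ∈ Set.Icc c (c + h / 2) ∧ ℓ i < h / 2
        · have := ih c (h / 2) (by rw [pow_succ] at hh; linarith) hs
          linarith
        push Not at hs
        rcases (s.filter fun i => x i ∈ Set.Icc c (c + h / 2)).eq_empty_or_nonempty with he | hne
        · rw [he, Finset.sum_empty]; positivity
        set F := s.filter fun i => x i ∈ Set.Icc c (c + h / 2) with hF
        set i := F.max' hne with hi
        have hiF : i ∈ F := F.max'_mem hne
        obtain ⟨his, hix⟩ := Finset.mem_filter.1 hiF
        -- Here every length in the half interval is at least `h / 2`, and `i` is its last, hence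
        -- shortest, member. If `ℓ i < h`, the density at `i` at scale `ℓ i` bounds the other
        -- masses, and `a i ≤ ℓ i` bounds the last one. Otherwise all lengths are at least `h > ℓ
        -- i₀`, so all these masses precede `i₀` and the density at `i₀` at scale `h` applies.
        by_cases hih : ℓ i < h
        · have hsub : F.erase i ⊆
              s.filter fun j => j < i ∧ |x j - x i| ≤ ℓ i ∧ ℓ i ≤ ℓ j := by
            intro j hj
            obtain ⟨hji, hjF⟩ := Finset.mem_erase.1 hj
            obtain ⟨hjs, hjx⟩ := Finset.mem_filter.1 hjF
            have hle : j ≤ i := F.le_max' j hjF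
            refine Finset.mem_filter.2 ⟨hjs, lt_of_le_of_ne hle hji, ?_, hanti j hjs i his hle⟩
            refine le_trans ?_ (hs i his hix)
            rw [abs_le]
            constructor <;> linarith [hjx.1, hjx.2, hix.1, hix.2]
          have h1 : ∑ j ∈ F.erase i, a j ≤ ℓ i :=
            (Finset.sum_le_sum_of_subset_of_nonneg hsub
              fun j hj _ => ha j (Finset.mem_filter.1 hj).1).trans (hden i his _ le_rfl)
          rw [← Finset.add_sum_erase F a hiF]
          linarith [haℓ i his]
        · have hsub : F ⊆ s.filter fun j => j < i₀ ∧ |x j - x i₀| ≤ h ∧ h ≤ ℓ j := by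
            intro j hjF
            obtain ⟨hjs, hjx⟩ := Finset.mem_filter.1 hjF
            have hle : j ≤ i := F.le_max' j hjF
            have hlj : h ≤ ℓ j := (not_lt.1 hih).trans (hanti j hjs i his hle)
            refine Finset.mem_filter.2 ⟨hjs, ?_, ?_, hlj⟩
            · by_contra hcon
              linarith [hanti i₀ hi₀ j hjs (not_lt.1 hcon)]
            · rw [abs_le]
              constructor <;> linarith [hjx.1, hjx.2, hx₀.1, hx₀.2]
          have h1 : ∑ j ∈ F, a j ≤ h :=
            (Finset.sum_le_sum_of_subset_of_nonneg hsub
              fun j hj _ => ha j (Finset.mem_filter.1 hj).1).trans (hden i₀ hi₀ _ hlt₀.le)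
          linarith
      have hsub : (s.filter fun i => x i ∈ Set.Icc b (b + h)) ⊆
          (s.filter fun i => x i ∈ Set.Icc b (b + h / 2)) ∪
            s.filter fun i => x i ∈ Set.Icc (b + h / 2) (b + h / 2 + h / 2) := by
        intro i hi
        obtain ⟨his, hix⟩ := Finset.mem_filter.1 hi
        rw [Finset.mem_union, Finset.mem_filter, Finset.mem_filter]
        rcases le_total (x i) (b + h / 2) with hc | hc
        · exact Or.inl ⟨his, hix.1, hc⟩
        · exact Or.inr ⟨his, hc, by linarith [hix.2]⟩
      have hU := Finset.sum_union_inter (f := a)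
        (s₁ := s.filter fun i => x i ∈ Set.Icc b (b + h / 2))
        (s₂ := s.filter fun i => x i ∈ Set.Icc (b + h / 2) (b + h / 2 + h / 2))
      have hI : 0 ≤ ∑ i ∈ (s.filter fun i => x i ∈ Set.Icc b (b + h / 2)) ∩
          s.filter fun i => x i ∈ Set.Icc (b + h / 2) (b + h / 2 + h / 2), a i :=
        Finset.sum_nonneg fun i hi => ha i (Finset.mem_filter.1 (Finset.mem_inter.1 hi).1).1
      have h0 := Finset.sum_le_sum_of_subset_of_nonneg (f := a) hsub (fun j hj _ => by
        rcases Finset.mem_union.1 hj with hj | hj <;> exact ha j (Finset.mem_filter.1 hj).1)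
      have h1 := half b le_rfl (by linarith)
      have h2 := half (b + h / 2) (by linarith) (by linarith)
      linarith
  obtain ⟨n, hn⟩ := pow_unbounded_of_one_lt (h / ε) (one_lt_two : (1 : ℝ) < 2)
  exact key n b h ((div_le_iff₀ hε).1 hn.le) hshort

/-- The weak type `(1, 1)` bound for the maximal function on the line, applied to the sum of the
indicators of finitely many sets `B j`. -/
theorem volume_le_of_forall_exists_interval {ι : Type*} (s : Finset ι) (B : ι → Set ℝ)
    (hB : ∀ j ∈ s, MeasurableSet (B j)) (hfin : ∀ j ∈ s, volume (B j) ≠ ∞) (E : Set ℝ)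
    (hE : ∀ y ∈ E, ∃ r > 0, ENNReal.ofReal (r / 2) <
      ∑ j ∈ s, volume (Set.Icc (y - r) (y + r) ∩ B j)) :
    volume E ≤ 20 * ∑ j ∈ s, volume (B j) := by
  classical
  have htot : ∑ j ∈ s, volume (B j) ≠ ∞ := ENNReal.sum_ne_top.2 hfin
  choose! r hr0 hr using hE
  have hbd : ∀ y ∈ E, r y ≤ 2 * (∑ j ∈ s, volume (B j)).toReal := by
    intro y hy
    have h1 : ENNReal.ofReal (r y / 2) ≤ ∑ j ∈ s, volume (B j) :=
      (hr y hy).le.trans (Finset.sum_le_sum fun j _ => measure_mono Set.inter_subset_right)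
    have := (ENNReal.ofReal_le_iff_le_toReal htot).1 h1
    linarith
  obtain ⟨u, huE, hdisj, hcov⟩ :=
    Vitali.exists_disjoint_subfamily_covering_enlargement_closedBall E (fun y : ℝ => y) r _ hbd 5
      (by norm_num)
  have hcount : u.Countable := by
    refine hdisj.countable_of_nonempty_interior fun y hy => ?_
    exact ⟨y, Metric.ball_subset_interior_closedBall (Metric.mem_ball_self (hr0 y (huE hy)))⟩
  have : Countable u := hcount.to_subtype
  calc volume E ≤ volume (⋃ y ∈ u, Metric.closedBall y (5 * r y)) := by
        refine measure_mono fun y hy => ?_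
        obtain ⟨z, hz, hsub⟩ := hcov y hy
        exact Set.mem_biUnion hz (hsub (Metric.mem_closedBall_self (hr0 y hy).le))
    _ ≤ ∑' y : u, volume (Metric.closedBall (y : ℝ) (5 * r y)) := measure_biUnion_le _ hcount _
    _ ≤ ∑' y : u, 20 * ∑ j ∈ s, volume (Metric.closedBall (y : ℝ) (r y) ∩ B j) := by
        refine ENNReal.tsum_le_tsum fun y => ?_
        rw [Real.volume_closedBall]
        have h1 := (hr y (huE y.2)).le
        rw [← Real.closedBall_eq_Icc] at h1
        calc ENNReal.ofReal (2 * (5 * r y)) = 20 * ENNReal.ofReal (r y / 2) := by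
              rw [← ENNReal.ofReal_ofNat 20, ← ENNReal.ofReal_mul (by norm_num)]
              congr 1; ring
          _ ≤ _ := by gcongr
    _ = 20 * ∑ j ∈ s, ∑' y : u, volume (Metric.closedBall (y : ℝ) (r y) ∩ B j) := by
        rw [ENNReal.tsum_mul_left, Summable.tsum_finsetSum fun _ _ => ENNReal.summable]
    _ ≤ 20 * ∑ j ∈ s, volume (B j) := by
        gcongr with j hj
        rw [← measure_iUnion]
        · exact measure_mono (Set.iUnion_subset fun y => Set.inter_subset_right)
        · intro y z hyz
          exact (hdisj y.2 z.2 (Subtype.coe_injective.ne hyz)).mono Set.inter_subset_left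
            Set.inter_subset_left
        · exact fun y => Metric.isClosed_closedBall.measurableSet.inter (hB j hj)

/-- A finite set can be selected greedily along a linear order. -/
theorem exists_greedy_selection {n : ℕ} (P : Fin n → Finset (Fin n) → Prop) :
    ∃ S : Finset (Fin n), ∀ i, i ∈ S ↔ P i (S.filter (· < i)) := by
  classical
  suffices h : ∀ m ≤ n, ∃ S : Finset (Fin n), (∀ i ∈ S, (i : ℕ) < m) ∧
      ∀ i : Fin n, (i : ℕ) < m → (i ∈ S ↔ P i (S.filter (· < i))) by
    obtain ⟨S, -, hS⟩ := h n le_rfl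
    exact ⟨S, fun i => hS i i.2⟩
  intro m
  induction m with
  | zero => exact fun _ => ⟨∅, by simp, by simp⟩
  | succ m ih =>
    intro hm
    obtain ⟨S, hSm, hS⟩ := ih (by omega)
    let k : Fin n := ⟨m, by omega⟩
    have hfilt : ∀ i : Fin n, (i : ℕ) ≤ m → (insert k S).filter (· < i) = S.filter (· < i) := by
      intro i hi
      rw [Finset.filter_insert, if_neg]
      rw [Fin.lt_def]; simpa [k] using hi
    have hkS : k ∉ S := fun h => lt_irrefl _ (hSm k h)
    have hSk : S.filter (· < k) = S :=
      Finset.filter_true_of_mem fun i hi => Fin.lt_def.2 (hSm i hi)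
    by_cases hP : P k S
    · refine ⟨insert k S, ?_, ?_⟩
      · intro i hi
        rcases Finset.mem_insert.1 hi with rfl | hi
        · exact Nat.lt_succ_self m
        · exact (hSm i hi).trans (Nat.lt_succ_self m)
      · intro i hi
        rw [hfilt i (Nat.lt_succ_iff.1 hi)]
        rcases (Nat.lt_succ_iff.1 hi).lt_or_eq with hi | hi
        · rw [Finset.mem_insert, ← hS i hi, or_iff_right]
          rintro rfl; exact lt_irrefl _ hi
        · obtain rfl : i = k := Fin.ext hi
          simp [hSk, hP]
    · refine ⟨S, fun i hi => (hSm i hi).trans (Nat.lt_succ_self m), fun i hi => ?_⟩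
      rcases (Nat.lt_succ_iff.1 hi).lt_or_eq with hi | hi
      · exact hS i hi
      · obtain rfl : i = k := Fin.ext hi
        rw [hSk]
        exact iff_of_false hkS hP

/-! ### Tubes and their dilates. -/

theorem measurableSet_graph_nhd {X : Set ℝ} (hX : MeasurableSet X) {φ : ℝ → ℝ}
    (hφ : Continuous φ) (w : ℝ) :
    MeasurableSet {z : ℝ × ℝ | z.1 ∈ X ∧ |z.2 - φ z.1| ≤ w} := by
  have h : Measurable fun z : ℝ × ℝ => |z.2 - φ z.1| :=
    (continuous_snd.sub (hφ.comp continuous_fst)).abs.measurable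
  exact (measurable_fst hX).inter (h measurableSet_Iic)

/-- The region of height `2 w` around the graph of `φ` over `X`. -/
theorem volume_graph_nhd {X : Set ℝ} (hX : MeasurableSet X) {φ : ℝ → ℝ} (hφ : Continuous φ)
    (w : ℝ) :
    volume {z : ℝ × ℝ | z.1 ∈ X ∧ |z.2 - φ z.1| ≤ w} = volume X * ENNReal.ofReal (2 * w) := by
  have hm := measurableSet_graph_nhd hX hφ w
  rw [Measure.volume_eq_prod, Measure.prod_apply hm]
  have : ∀ x, volume (Prod.mk x ⁻¹' {z : ℝ × ℝ | z.1 ∈ X ∧ |z.2 - φ z.1| ≤ w}) =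
      X.indicator (fun _ => ENNReal.ofReal (2 * w)) x := by
    intro x
    by_cases hx : x ∈ X
    · have : Prod.mk x ⁻¹' {z : ℝ × ℝ | z.1 ∈ X ∧ |z.2 - φ z.1| ≤ w} =
          Metric.closedBall (φ x) w := by
        ext y; simp [hx, Real.dist_eq]
      rw [this, Real.volume_closedBall, Set.indicator_of_mem hx]
    · have : Prod.mk x ⁻¹' {z : ℝ × ℝ | z.1 ∈ X ∧ |z.2 - φ z.1| ≤ w} = ∅ := by
        ext y; simp [hx]
      rw [this, measure_empty, Set.indicator_of_notMem hx]
  simp_rw [this]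
  rw [lintegral_indicator hX, setLIntegral_const, mul_comm]

/-- A parallelogram with two vertical sides: center `(p, q)`, half-length `ℓ`, vertical
half-width `w` and slope `m`. -/
structure Tube where
  p : ℝ
  q : ℝ
  ℓ : ℝ
  w : ℝ
  m : ℝ
  ℓ_pos : 0 < ℓ
  w_pos : 0 < w

namespace Tube

/-- The axis of the tube, as a function. -/
def line (T : Tube) (x : ℝ) : ℝ := T.q + T.m * (x - T.p)

/-- The points of the tube. -/
def toSet (T : Tube) : Set (ℝ × ℝ) :=
  {z | z.1 ∈ Metric.closedBall T.p T.ℓ ∧ |z.2 - T.line z.1| ≤ T.w}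

/-- The vertical slices of the tube dilated by the factor `20`. -/
def dilSlice (T : Tube) (x : ℝ) : Set ℝ :=
  {y | x ∈ Metric.closedBall T.p (20 * T.ℓ) ∧ |y - T.line x| ≤ 20 * T.w}

theorem continuous_line (T : Tube) : Continuous T.line := by
  unfold line; fun_prop

theorem mem_toSet {T : Tube} {z : ℝ × ℝ} :
    z ∈ T.toSet ↔ |z.1 - T.p| ≤ T.ℓ ∧ |z.2 - T.line z.1| ≤ T.w := by
  simp [toSet, Real.dist_eq]

theorem measurableSet_toSet (T : Tube) : MeasurableSet T.toSet :=
  measurableSet_graph_nhd Metric.isClosed_closedBall.measurableSet T.continuous_line T.w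

/-- The area of the tube. -/
def area (T : Tube) : ℝ := 4 * T.ℓ * T.w

theorem area_pos (T : Tube) : 0 < T.area := by
  have := T.ℓ_pos; have := T.w_pos; unfold area; positivity

theorem volume_toSet (T : Tube) : volume T.toSet = ENNReal.ofReal T.area := by
  unfold toSet
  rw [volume_graph_nhd Metric.isClosed_closedBall.measurableSet T.continuous_line,
    Real.volume_closedBall, ← ENNReal.ofReal_mul (by linarith [T.ℓ_pos])]
  congr 1; unfold area; ring

theorem measurableSet_dilSlice (T : Tube) (x : ℝ) : MeasurableSet (T.dilSlice x) := by
  have h : Measurable fun y : ℝ => |y - T.line x| := by fun_prop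
  exact (MeasurableSet.const _).inter (h measurableSet_Iic)

theorem lintegral_volume_dilSlice (T : Tube) :
    ∫⁻ x, volume (T.dilSlice x) = ENNReal.ofReal (400 * T.area) := by
  have hm : MeasurableSet {z : ℝ × ℝ | z.1 ∈ Metric.closedBall T.p (20 * T.ℓ) ∧
      |z.2 - T.line z.1| ≤ 20 * T.w} :=
    measurableSet_graph_nhd Metric.isClosed_closedBall.measurableSet T.continuous_line _
  have h := volume_graph_nhd (Metric.isClosed_closedBall.measurableSet
    (s := Metric.closedBall T.p (20 * T.ℓ))) T.continuous_line (20 * T.w)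
  rw [Measure.volume_eq_prod, Measure.prod_apply hm, Real.volume_closedBall,
    ← ENNReal.ofReal_mul (by linarith [T.ℓ_pos])] at h
  refine Eq.trans ?_ (h.trans ?_)
  · rfl
  · congr 1; unfold area; ring

theorem measurable_volume_dilSlice (T : Tube) : Measurable fun x => volume (T.dilSlice x) := by
  have hm : MeasurableSet {z : ℝ × ℝ | z.1 ∈ Metric.closedBall T.p (20 * T.ℓ) ∧
      |z.2 - T.line z.1| ≤ 20 * T.w} :=
    measurableSet_graph_nhd Metric.isClosed_closedBall.measurableSet T.continuous_line _
  exact measurable_measure_prodMk_left hm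

theorem volume_dilSlice_ne_top (T : Tube) (x : ℝ) : volume (T.dilSlice x) ≠ ∞ := by
  refine ((measure_mono (t := Metric.closedBall (T.line x) (20 * T.w)) ?_).trans_lt
    measure_closedBall_lt_top).ne
  intro y hy
  rw [Metric.mem_closedBall, Real.dist_eq]
  exact hy.2

/-! ### Free points. -/

/-- The point `z` is free of the dilated tubes `T j`, `j ∈ S`, if on every vertical interval
centered at `z` they have mean multiplicity at most `1 / 4`. -/
def Free {ι : Type*} (T : ι → Tube) (S : Finset ι) (z : ℝ × ℝ) : Prop :=
  ∀ r > 0, ∑ j ∈ S, volume (Set.Icc (z.2 - r) (z.2 + r) ∩ (T j).dilSlice z.1) ≤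
    ENNReal.ofReal (r / 2)

/-- Freeness is tested on the interval of radius `2 * D`, which contains the part of each slice
within `min (20 * w) D` of its axis. The dilation factor `20` outweighs the constants in the values
of `D` used later. -/
theorem Free.sum_width_le {ι : Type*} {T : ι → Tube} {S P : Finset ι} {z : ℝ × ℝ}
    (hfree : Free T S z) (hP : P ⊆ S) {D : ℝ} (hD : 0 < D)
    (hx : ∀ j ∈ P, |z.1 - (T j).p| ≤ 20 * (T j).ℓ)
    (hy : ∀ j ∈ P, |(T j).line z.1 - z.2| ≤ D) :
    ∑ j ∈ P, 20 * (T j).w ≤ D / 2 := by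
  have hmin : ∀ j, 0 ≤ min (20 * (T j).w) D := fun j =>
    le_min (by linarith [(T j).w_pos]) hD.le
  have hle : ∑ j ∈ P, 2 * min (20 * (T j).w) D ≤ D := by
    have h1 := hfree (2 * D) (by linarith)
    have h2 : ENNReal.ofReal (∑ j ∈ P, 2 * min (20 * (T j).w) D) ≤
        ∑ j ∈ S, volume (Set.Icc (z.2 - 2 * D) (z.2 + 2 * D) ∩ (T j).dilSlice z.1) := by
      rw [ENNReal.ofReal_sum_of_nonneg fun j _ => by have := hmin j; positivity]
      refine le_trans (Finset.sum_le_sum fun j hj => ?_) (Finset.sum_le_sum_of_subset hP)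
      rw [← Real.volume_closedBall ((T j).line z.1)]
      refine measure_mono fun y hyb => ?_
      rw [Metric.mem_closedBall, Real.dist_eq] at hyb
      have h3 := hyb.trans (min_le_right _ _)
      have h4 := hy j hj
      rw [abs_le] at h3 h4
      refine ⟨⟨by linarith, by linarith⟩, ?_, hyb.trans (min_le_left _ _)⟩
      rw [Metric.mem_closedBall, Real.dist_eq]
      exact hx j hj
    have h5 := h2.trans h1
    rw [ENNReal.ofReal_le_ofReal_iff (by linarith)] at h5
    linarith
  -- A single summand is already at most `D`, so the minimum is at most `D / 2` and cannot be `D`.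
  have heq : ∀ j ∈ P, min (20 * (T j).w) D = 20 * (T j).w := by
    intro j hj
    have h1 := Finset.single_le_sum (f := fun j => 2 * min (20 * (T j).w) D)
      (fun i _ => by have := hmin i; positivity) hj
    refine min_eq_left ?_
    by_contra hcon
    rw [not_le] at hcon
    have h2 := h1.trans hle
    simp only [min_eq_right hcon.le] at h2
    linarith
  rw [Finset.sum_congr rfl fun j hj => by rw [heq j hj], ← Finset.mul_sum] at hle
  linarith

/-! ### Two intersecting tubes. -/

theorem line_sub_line (R Q : Tube) (x x₀ : ℝ) :
    R.line x - Q.line x = (R.line x₀ - Q.line x₀) + (R.m - Q.m) * (x - x₀) := by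
  unfold line; ring

/-- The abscissa at which the axes of two tubes cross. -/
noncomputable def cross (R Q : Tube) : ℝ := Q.p - (R.line Q.p - Q.line Q.p) / (R.m - Q.m)

theorem line_sub_line_cross {R Q : Tube} (h : R.m - Q.m ≠ 0) (x : ℝ) :
    R.line x - Q.line x = (R.m - Q.m) * (x - R.cross Q) := by
  rw [line_sub_line R Q x Q.p]
  unfold cross
  field_simp
  ring

theorem abs_line_sub_line_le_of_mem {R Q : Tube} {z : ℝ × ℝ} (hR : z ∈ R.toSet)
    (hQ : z ∈ Q.toSet) : |R.line z.1 - Q.line z.1| ≤ R.w + Q.w := by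
  have h1 := abs_le.1 (mem_toSet.1 hR).2
  have h2 := abs_le.1 (mem_toSet.1 hQ).2
  rw [abs_le]
  constructor <;> linarith

theorem abs_line_sub_le {R Q : Tube} {z z₀ : ℝ × ℝ} (hz : z ∈ R.toSet) (hR : z₀ ∈ R.toSet)
    (hQ : z₀ ∈ Q.toSet) :
    |Q.line z.1 - z.2| ≤ 2 * R.w + Q.w + 2 * (|R.m - Q.m| * R.ℓ) := by
  have h1 := abs_line_sub_line_le_of_mem hR hQ
  have h2 := line_sub_line R Q z.1 z₀.1
  have h3 := abs_le.1 (mem_toSet.1 hz).1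
  have h4 := abs_le.1 (mem_toSet.1 hR).1
  have h5 : |z.1 - z₀.1| ≤ 2 * R.ℓ := by rw [abs_le]; constructor <;> linarith
  have h6 : |(R.m - Q.m) * (z.1 - z₀.1)| ≤ |R.m - Q.m| * (2 * R.ℓ) := by
    rw [abs_mul]; gcongr
  have h7 := (mem_toSet.1 hz).2
  rw [abs_le] at h1 h6 h7 ⊢
  constructor <;> linarith

theorem abs_sub_center_le {R Q : Tube} {z z₀ : ℝ × ℝ} (hz : z ∈ R.toSet) (hR : z₀ ∈ R.toSet)
    (hQ : z₀ ∈ Q.toSet) (hℓ : R.ℓ ≤ Q.ℓ) : |z.1 - Q.p| ≤ 3 * Q.ℓ := by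
  have h3 := abs_le.1 (mem_toSet.1 hz).1
  have h4 := abs_le.1 (mem_toSet.1 hR).1
  have h5 := abs_le.1 (mem_toSet.1 hQ).1
  rw [abs_le]; constructor <;> linarith

theorem volume_inter_le_parallel (R Q : Tube) :
    volume (R.toSet ∩ Q.toSet) ≤ ENNReal.ofReal (4 * R.ℓ * Q.w) := by
  calc volume (R.toSet ∩ Q.toSet)
      ≤ volume {z : ℝ × ℝ | z.1 ∈ Metric.closedBall R.p R.ℓ ∧ |z.2 - Q.line z.1| ≤ Q.w} :=
        measure_mono fun z hz => ⟨hz.1.1, hz.2.2⟩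
    _ = _ := by
        rw [volume_graph_nhd Metric.isClosed_closedBall.measurableSet Q.continuous_line,
          Real.volume_closedBall, ← ENNReal.ofReal_mul (by linarith [R.ℓ_pos])]
        congr 1; ring

/-- The intersection projects into an interval of half-length `(R.w + Q.w) / |R.m - Q.m|` about the
crossing abscissa, and is vertically no thicker than the thinner tube. -/
theorem volume_inter_le_transversal {R Q : Tube} (h : R.m - Q.m ≠ 0) :
    volume (R.toSet ∩ Q.toSet) ≤ ENNReal.ofReal (8 * Q.w * (R.w / |R.m - Q.m|)) := by
  have hθ : 0 < |R.m - Q.m| := abs_pos.2 h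
  have hR := R.w_pos
  have hQ := Q.w_pos
  have hx : ∀ z ∈ R.toSet ∩ Q.toSet,
      z.1 ∈ Metric.closedBall (R.cross Q) ((R.w + Q.w) / |R.m - Q.m|) := by
    intro z hz
    have h1 := abs_line_sub_line_le_of_mem hz.1 hz.2
    rw [line_sub_line_cross h, abs_mul] at h1
    rw [Metric.mem_closedBall, Real.dist_eq, le_div_iff₀ hθ, mul_comm]
    exact h1
  have bound : ∀ P : Tube, R.toSet ∩ Q.toSet ⊆ P.toSet → volume (R.toSet ∩ Q.toSet) ≤
      ENNReal.ofReal (4 * P.w * ((R.w + Q.w) / |R.m - Q.m|)) := by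
    intro P hP
    calc volume (R.toSet ∩ Q.toSet)
        ≤ volume {z : ℝ × ℝ | z.1 ∈ Metric.closedBall (R.cross Q) ((R.w + Q.w) / |R.m - Q.m|) ∧
            |z.2 - P.line z.1| ≤ P.w} := measure_mono fun z hz => ⟨hx z hz, (hP hz).2⟩
      _ = _ := by
          rw [volume_graph_nhd Metric.isClosed_closedBall.measurableSet P.continuous_line,
            Real.volume_closedBall, ← ENNReal.ofReal_mul (by positivity)]
          congr 1; ring
  rcases le_total R.w Q.w with hle | hle
  · refine (bound R Set.inter_subset_left).trans (ENNReal.ofReal_le_ofReal ?_)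
    rw [mul_div_assoc', mul_div_assoc']
    exact div_le_div_of_nonneg_right (by nlinarith) hθ.le
  · refine (bound Q Set.inter_subset_right).trans (ENNReal.ofReal_le_ofReal ?_)
    rw [mul_div_assoc', mul_div_assoc']
    exact div_le_div_of_nonneg_right (by nlinarith) hθ.le

/-! ### Selected families: widths and nearly parallel pairs. -/

variable {n : ℕ}

/-- A subfamily of tubes each of which has a point free of the preceding ones. -/
def Selected (T : Fin n → Tube) (S : Finset (Fin n)) : Prop :=
  ∀ i ∈ S, ∃ z ∈ (T i).toSet, Free T (S.filter (· < i)) z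

variable {T : Fin n → Tube} {S : Finset (Fin n)}

/-- An earlier tube too wide for this bound would have a dilate crowding the free point of `T i`.
Freeness with one tube gives `40 * (T j).w ≤ D`, and the term `(T j).w` inside `D` is absorbed. -/
theorem Selected.width_le (hS : Selected T S) (hanti : ∀ i j, i ≤ j → (T j).ℓ ≤ (T i).ℓ)
    {i j : Fin n} (hi : i ∈ S) (hj : j ∈ S) (hji : j < i)
    (hmeet : ((T i).toSet ∩ (T j).toSet).Nonempty) :
    39 * (T j).w ≤ 2 * (T i).w + 2 * (|(T i).m - (T j).m| * (T i).ℓ) := by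
  obtain ⟨z, hz, hfree⟩ := hS i hi
  obtain ⟨z₀, h₀i, h₀j⟩ := hmeet
  have h := hfree.sum_width_le (P := {j})
    (D := 2 * (T i).w + (T j).w + 2 * (|(T i).m - (T j).m| * (T i).ℓ))
    (by simpa using ⟨hj, hji⟩)
    (by
      have := (T i).w_pos; have := (T j).w_pos; have := (T i).ℓ_pos
      positivity)
    (by
      intro k hk
      rw [Finset.mem_singleton.1 hk]
      exact (abs_sub_center_le hz h₀i h₀j (hanti j i hji.le)).trans
        (by linarith [(T j).ℓ_pos]))
    (by
      intro k hk
      rw [Finset.mem_singleton.1 hk]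
      exact abs_line_sub_le hz h₀i h₀j)
  rw [Finset.sum_singleton] at h
  linarith

-- For nearly parallel tubes `Selected.width_le` yields `(T j).w ≤ (T i).w`, so every axis passes
-- within `(2 + 1 + 20) * (T i).w` of the free point of `T i`.
open scoped Classical in
theorem Selected.sum_width_parallel_le (hS : Selected T S)
    (hanti : ∀ i j, i ≤ j → (T j).ℓ ≤ (T i).ℓ) {i : Fin n} (hi : i ∈ S) :
    ∑ j ∈ S with j < i ∧ ((T i).toSet ∩ (T j).toSet).Nonempty ∧
      |(T i).m - (T j).m| * (T i).ℓ ≤ 10 * (T i).w, (T j).w ≤ (T i).w := by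
  obtain ⟨z, hz, hfree⟩ := hS i hi
  have hw := (T i).w_pos
  have h := hfree.sum_width_le (P := S.filter fun j => j < i ∧
      ((T i).toSet ∩ (T j).toSet).Nonempty ∧ |(T i).m - (T j).m| * (T i).ℓ ≤ 10 * (T i).w)
    (D := 23 * (T i).w)
    (fun j hj => by
      rw [Finset.mem_filter] at hj ⊢
      exact ⟨hj.1, hj.2.1⟩)
    (by positivity)
    (by
      intro j hj
      obtain ⟨-, hji, ⟨z₀, h₀i, h₀j⟩, -⟩ := Finset.mem_filter.1 hj
      exact (abs_sub_center_le hz h₀i h₀j (hanti j i hji.le)).trans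
        (by linarith [(T j).ℓ_pos]))
    (by
      intro j hj
      obtain ⟨hjS, hji, hmeet, hθ⟩ := Finset.mem_filter.1 hj
      have h1 := hS.width_le hanti hi hjS hji hmeet
      obtain ⟨z₀, h₀i, h₀j⟩ := hmeet
      have h2 := abs_line_sub_le hz h₀i h₀j
      linarith)
  rw [← Finset.mul_sum] at h
  linarith

/-! ### Transversal crossings and the slope field. -/

/-- The tube `R` crosses the tube `Q` at an angle which is large compared with the eccentricity
of `R`, while the width of `Q` is small. -/
structure Transversal (R Q : Tube) : Prop where
  meet : (R.toSet ∩ Q.toSet).Nonempty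
  length_le : R.ℓ ≤ Q.ℓ
  width_le : 10 * R.w ≤ |R.m - Q.m| * R.ℓ
  width_le' : 10 * Q.w ≤ |R.m - Q.m| * R.ℓ

namespace Transversal

variable {R Q : Tube}

theorem angle_pos (h : Transversal R Q) : 0 < |R.m - Q.m| := by
  by_contra hcon
  have h0 : |R.m - Q.m| = 0 := le_antisymm (not_lt.1 hcon) (abs_nonneg _)
  have := h.width_le
  rw [h0] at this
  linarith [R.w_pos]

theorem slope_ne (h : Transversal R Q) : R.m - Q.m ≠ 0 := abs_pos.1 h.angle_pos

theorem exists_abs_sub_cross_le (h : Transversal R Q) :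
    ∃ x, |x - R.p| ≤ R.ℓ ∧ |x - Q.p| ≤ Q.ℓ ∧ |x - R.cross Q| ≤ R.ℓ / 5 := by
  obtain ⟨z, hR, hQ⟩ := h.meet
  refine ⟨z.1, (mem_toSet.1 hR).1, (mem_toSet.1 hQ).1, ?_⟩
  have h1 := abs_line_sub_line_le_of_mem hR hQ
  rw [line_sub_line_cross h.slope_ne, abs_mul] at h1
  have h2 := h.width_le
  have h3 := h.width_le'
  refine le_of_mul_le_mul_left ?_ h.angle_pos
  linarith

theorem abs_cross_sub_le (h : Transversal R Q) : |R.cross Q - R.p| ≤ 6 / 5 * R.ℓ := by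
  obtain ⟨x, h1, -, h2⟩ := h.exists_abs_sub_cross_le
  rw [abs_le] at *
  constructor <;> linarith

theorem abs_cross_sub_le' (h : Transversal R Q) : |R.cross Q - Q.p| ≤ 6 / 5 * Q.ℓ := by
  obtain ⟨x, -, h1, h2⟩ := h.exists_abs_sub_cross_le
  have := h.length_le
  rw [abs_le] at *
  constructor <;> linarith

theorem abs_sub_cross_le (h : Transversal R Q) {x : ℝ} (hx : |x - R.p| ≤ R.ℓ) :
    |x - R.cross Q| ≤ 11 / 5 * R.ℓ := by
  have := h.abs_cross_sub_le
  rw [abs_le] at *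
  constructor <;> linarith

end Transversal

/-- Among selected tubes crossing `Q` at comparable angles, the crossing widths satisfy the
density bound of `sum_mass_le_of_density`. -/
theorem Selected.density_le (hS : Selected T S) {Q : Tube} {i : Fin n} (hi : i ∈ S)
    (hiQ : Transversal (T i) Q) {r : ℝ} (hr : (T i).ℓ ≤ r) (P : Finset (Fin n)) (hPS : P ⊆ S)
    (hPQ : ∀ j ∈ P, Transversal (T j) Q) (hPi : ∀ j ∈ P, j < i)
    (hclose : ∀ j ∈ P, |(T j).cross Q - (T i).cross Q| ≤ r) (hlong : ∀ j ∈ P, r ≤ (T j).ℓ)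
    (hcomp : ∀ j ∈ P, |(T j).m - Q.m| ≤ 9 / 4 * |(T i).m - Q.m|)
    (hcomp' : ∀ j ∈ P, |(T i).m - Q.m| ≤ 9 / 4 * |(T j).m - Q.m|) :
    ∑ j ∈ P, (T j).w / |(T j).m - Q.m| ≤ r := by
  obtain ⟨z, hz, hfree⟩ := hS i hi
  set θ := |(T i).m - Q.m| with hθdef
  have hθ : 0 < θ := hiQ.angle_pos
  have hr0 : 0 < r := (T i).ℓ_pos.trans_le hr
  have hzi := hiQ.abs_sub_cross_le (mem_toSet.1 hz).1
  have hzj : ∀ j ∈ P, |z.1 - (T j).cross Q| ≤ 16 / 5 * r := by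
    intro j hj
    have := hclose j hj
    rw [abs_le] at *
    constructor <;> linarith
  -- The distance from the free point to the axis of `T j` is at most `9/4 * 16/5 + 11/5 + 1/10 =
  -- 9.5` times `θ * r`, passing through the axes of `Q` and `T i`.
  have h := hfree.sum_width_le (P := P) (D := 10 * (θ * r))
    (fun j hj => Finset.mem_filter.2 ⟨hPS hj, hPi j hj⟩)
    (by positivity)
    (by
      intro j hj
      have h1 := hzj j hj
      have h2 := (hPQ j hj).abs_cross_sub_le
      have h3 := hlong j hj
      rw [abs_le] at *
      constructor <;> linarith)
    (by
      intro j hj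
      have h1 : |(T j).line z.1 - Q.line z.1| ≤ 9 / 4 * θ * (16 / 5 * r) := by
        rw [line_sub_line_cross (hPQ j hj).slope_ne, abs_mul]
        exact mul_le_mul (hcomp j hj) (hzj j hj) (abs_nonneg _) (by positivity)
      have h2 : |(T i).line z.1 - Q.line z.1| ≤ θ * (11 / 5 * r) := by
        rw [line_sub_line_cross hiQ.slope_ne, abs_mul]
        exact mul_le_mul_of_nonneg_left (hzi.trans (by linarith)) hθ.le
      have h3 := (mem_toSet.1 hz).2
      have h4 : 10 * (T i).w ≤ θ * r :=
        hiQ.width_le.trans (mul_le_mul_of_nonneg_left hr hθ.le)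
      have h5 : 0 < θ * r := by positivity
      rw [abs_le] at h1 h2 h3 ⊢
      constructor <;> nlinarith)
  rw [← Finset.mul_sum] at h
  calc ∑ j ∈ P, (T j).w / |(T j).m - Q.m| ≤ ∑ j ∈ P, 9 / 4 * (T j).w / θ := by
        refine Finset.sum_le_sum fun j hj => ?_
        rw [div_le_div_iff₀ (hPQ j hj).angle_pos hθ]
        have := hcomp' j hj
        nlinarith [(T j).w_pos]
    _ = 9 / 4 * (∑ j ∈ P, (T j).w) / θ := by rw [← Finset.sum_div, ← Finset.mul_sum]
    _ ≤ r := by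
        rw [div_le_iff₀ hθ]
        nlinarith

/-- Selected tubes crossing `Q` within a bounded multiple of `ℓ₀` at comparable angles. -/
theorem Selected.sum_crossing_le (hS : Selected T S)
    (hanti : ∀ i j, i ≤ j → (T j).ℓ ≤ (T i).ℓ) {Q : Tube} (G : Finset (Fin n)) (hGS : G ⊆ S)
    (hGQ : ∀ i ∈ G, Transversal (T i) Q)
    (hcomp : ∀ i ∈ G, ∀ j ∈ G, |(T i).m - Q.m| ≤ 9 / 4 * |(T j).m - Q.m|)
    {k : Fin n} (hk : k ∈ G)
    (hclose : ∀ i ∈ G, |(T i).cross Q - (T k).cross Q| ≤ 7 * (T k).ℓ) :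
    ∑ i ∈ G, (T i).w / |(T i).m - Q.m| ≤ 56 * (T k).ℓ := by
  have hkpos := (T k).ℓ_pos
  have h := sum_mass_le_of_density G (fun i => (T i).cross Q)
    (fun i => (T i).w / |(T i).m - Q.m|) (fun i => (T i).ℓ) (fun i _ => (T i).ℓ_pos)
    (fun i _ => div_nonneg (T i).w_pos.le (abs_nonneg _))
    (fun i hi => by
      rw [div_le_iff₀ (hGQ i hi).angle_pos]
      linarith [(hGQ i hi).width_le, (T i).w_pos])
    (fun i _ j _ hij => hanti i j hij)
    (fun i hi r hr => by
      refine hS.density_le (hGS hi) (hGQ i hi) hr _ ((Finset.filter_subset _ _).trans hGS)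
        ?_ ?_ ?_ ?_ ?_ ?_ <;> intro j hj <;> obtain ⟨hjG, hji, hd, hl⟩ := Finset.mem_filter.1 hj
      · exact hGQ j hjG
      · exact hji
      · exact hd
      · exact hl
      · exact hcomp j hjG i hi
      · exact hcomp i hi j hjG)
    ((T k).cross Q - 7 * (T k).ℓ) (14 * (T k).ℓ)
    ⟨k, hk, ⟨by linarith, by linarith⟩, by linarith⟩
  rw [Finset.filter_true_of_mem] at h
  · linarith
  · intro i hi
    have := abs_le.1 (hclose i hi)
    exact ⟨by linarith, by linarith⟩

/-- A vertically Lipschitz slope field follows the slope of `R` on a large part of the axis of a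
tube `Q` crossed by `R`. -/
theorem Transversal.volume_le {R Q : Tube} (h : Transversal R Q) {σ : ℝ × ℝ → ℝ}
    (hσ : Continuous σ) {K : ℝ} (hK0 : 0 ≤ K)
    (hK : ∀ x y y', |σ (x, y) - σ (x, y')| ≤ K * |y - y'|) (hKℓ : K * R.ℓ ≤ 1 / 25)
    {δ : ℝ} {V : Set (ℝ × ℝ)} (hV : V ⊆ R.toSet) (hVσ : ∀ z ∈ V, |σ z - R.m| ≤ R.w / R.ℓ)
    (hVδ : ENNReal.ofReal (δ * R.area) ≤ volume V) :
    ENNReal.ofReal (2 * δ * R.ℓ) ≤ volume {x | |x - R.p| ≤ R.ℓ ∧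
      |σ (x, Q.line x) - R.m| ≤ |R.m - Q.m| / 5} := by
  set U := {x | |x - R.p| ≤ R.ℓ ∧ |σ (x, Q.line x) - R.m| ≤ |R.m - Q.m| / 5} with hU
  have hw := R.w_pos
  have hℓ := R.ℓ_pos
  have hθ := h.angle_pos
  have hQc := Q.continuous_line
  have hUm : MeasurableSet U := by
    have h1 : Continuous fun x => |x - R.p| := by fun_prop
    have h2 : Continuous fun x => |σ (x, Q.line x) - R.m| := by fun_prop
    exact (h1.measurable measurableSet_Iic).inter (h2.measurable measurableSet_Iic)
  have hsub : V ⊆ {z : ℝ × ℝ | z.1 ∈ U ∧ |z.2 - R.line z.1| ≤ R.w} := by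
    rintro ⟨x, y⟩ hz
    obtain ⟨hx, hy⟩ := mem_toSet.1 (hV hz)
    simp only at hx hy
    refine ⟨⟨hx, ?_⟩, hy⟩
    have h1 := hVσ _ hz
    have h2 : R.w / R.ℓ ≤ |R.m - Q.m| / 10 := by
      rw [div_le_div_iff₀ hℓ (by norm_num)]
      linarith [h.width_le]
    have h3 : |R.line x - Q.line x| ≤ |R.m - Q.m| * (11 / 5 * R.ℓ) := by
      rw [line_sub_line_cross h.slope_ne, abs_mul]
      exact mul_le_mul_of_nonneg_left (h.abs_sub_cross_le hx) hθ.le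
    -- The vertical move has length at most `(11/5 + 1/10) * θ * ℓ` with `θ = |R.m - Q.m|`; with `K
    -- * ℓ ≤ 1 / 25` it changes `σ` by at most `θ / 10`. The other `θ / 10` comes from the aperture
    -- `w / ℓ`.
    have h4 : |y - Q.line x| ≤ 5 / 2 * (|R.m - Q.m| * R.ℓ) := by
      have := h.width_le
      rw [abs_le] at h3 hy ⊢
      constructor <;> linarith [mul_pos hθ hℓ]
    have h5 : |σ (x, y) - σ (x, Q.line x)| ≤ |R.m - Q.m| / 10 := by
      refine (hK x y (Q.line x)).trans ((mul_le_mul_of_nonneg_left h4 hK0).trans ?_)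
      nlinarith
    have h6 := h1.trans h2
    rw [abs_le] at h5 h6 ⊢
    constructor <;> linarith
  -- Fubini: `V` has vertical extent at most `2 * R.w` above each point of `U`.
  have hle := hVδ.trans (measure_mono hsub)
  rw [volume_graph_nhd hUm R.continuous_line] at hle
  have h2w : 0 < 2 * R.w := by positivity
  have : ENNReal.ofReal (δ * R.area) = ENNReal.ofReal (2 * δ * R.ℓ) * ENNReal.ofReal (2 * R.w) := by
    rw [← ENNReal.ofReal_mul' h2w.le]
    congr 1; unfold area; ring
  rw [this] at hle
  exact (ENNReal.mul_le_mul_iff_left (ENNReal.ofReal_pos.2 h2w).ne' ENNReal.ofReal_ne_top).1 hle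

/-- The Vitali selection is applied to the sets `U i` where the field on the axis of `Q` follows `T
i`, not to the whole projections. Meeting of these sets is what makes angles comparable, and their
disjointness still bounds the lengths of the leaders, at the cost of `δ⁻¹`. -/
theorem Selected.sum_transversal_le (hS : Selected T S)
    (hanti : ∀ i j, i ≤ j → (T j).ℓ ≤ (T i).ℓ) {Q : Tube} (G : Finset (Fin n)) (hGS : G ⊆ S)
    (hGQ : ∀ i ∈ G, Transversal (T i) Q) {σ : ℝ × ℝ → ℝ}
    (hσ : Continuous σ) {K : ℝ} (hK0 : 0 ≤ K)
    (hK : ∀ x y y', |σ (x, y) - σ (x, y')| ≤ K * |y - y'|) (hKℓ : ∀ i, K * (T i).ℓ ≤ 1 / 25)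
    {δ : ℝ} (hδ : 0 < δ) {V : Fin n → Set (ℝ × ℝ)} (hV : ∀ i, V i ⊆ (T i).toSet)
    (hVσ : ∀ i, ∀ z ∈ V i, |σ z - (T i).m| ≤ (T i).w / (T i).ℓ)
    (hVδ : ∀ i, ENNReal.ofReal (δ * (T i).area) ≤ volume (V i)) :
    ∑ i ∈ G, (T i).w / |(T i).m - Q.m| ≤ 224 * δ⁻¹ * Q.ℓ := by
  classical
  set U : Fin n → Set ℝ := fun i => {x | |x - (T i).p| ≤ (T i).ℓ ∧
    |σ (x, Q.line x) - (T i).m| ≤ |(T i).m - Q.m| / 5} with hU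
  have hQc := Q.continuous_line
  have hUm : ∀ i, MeasurableSet (U i) := by
    intro i
    have h1 : Continuous fun x => |x - (T i).p| := by fun_prop
    have h2 : Continuous fun x => |σ (x, Q.line x) - (T i).m| := by fun_prop
    exact (h1.measurable measurableSet_Iic).inter (h2.measurable measurableSet_Iic)
  have hUδ : ∀ i ∈ G, ENNReal.ofReal (2 * δ * (T i).ℓ) ≤ volume (U i) := fun i hi =>
    (hGQ i hi).volume_le hσ hK0 hK (hKℓ i) (hV i) (hVσ i) (hVδ i)
  have hUne : ∀ i ∈ G, (U i).Nonempty := by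
    intro i hi
    refine nonempty_of_measure_ne_zero (μ := volume) (ne_of_gt (lt_of_lt_of_le ?_ (hUδ i hi)))
    exact ENNReal.ofReal_pos.2 (by have := (T i).ℓ_pos; positivity)
  obtain ⟨u, huG, hdisj, hcov⟩ := Vitali.exists_disjoint_subfamily_covering_enlargement U
    (G : Set (Fin n)) (fun i => (T i).ℓ) 2 (by norm_num) (fun i _ => (T i).ℓ_pos.le) Q.ℓ
    (fun i hi => (hGQ i hi).length_le) hUne
  choose! c hcu hcne hcℓ using hcov
  set F := G.filter (· ∈ u) with hF
  have hgroup : ∀ k ∈ F, ∑ i ∈ G with c i = k, (T i).w / |(T i).m - Q.m| ≤ 56 * (T k).ℓ := by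
    intro k hkF
    obtain ⟨hkG, hku⟩ := Finset.mem_filter.1 hkF
    set H := G.filter fun i => (U i ∩ U k).Nonempty ∧ (T i).ℓ ≤ 2 * (T k).ℓ with hH
    have hHG : H ⊆ G := Finset.filter_subset _ _
    have hkH : k ∈ H := by
      refine Finset.mem_filter.2 ⟨hkG, ?_, by linarith [(T k).ℓ_pos]⟩
      rw [Set.inter_self]; exact hUne k hkG
    have hsub : (G.filter fun i => c i = k) ⊆ H := by
      intro i hi
      obtain ⟨hiG, rfl⟩ := Finset.mem_filter.1 hi
      exact Finset.mem_filter.2 ⟨hiG, hcne i hiG, hcℓ i hiG⟩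
    refine (Finset.sum_le_sum_of_subset_of_nonneg hsub
      fun i _ _ => div_nonneg (T i).w_pos.le (abs_nonneg _)).trans ?_
    -- At a common point of `U i` and `U k` one value of `σ` approximates both slopes, so `4/5` of
    -- either angle is at most `6/5` of the other. Comparing two members through `k` gives the
    -- factor `9/4`.
    have hangle : ∀ i ∈ H, |(T i).m - Q.m| ≤ 3 / 2 * |(T k).m - Q.m| ∧
        |(T k).m - Q.m| ≤ 3 / 2 * |(T i).m - Q.m| := by
      intro i hi
      obtain ⟨-, ⟨x, hxi, hxk⟩, -⟩ := Finset.mem_filter.1 hi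
      have h1 : |(T i).m - (T k).m| ≤ |(T i).m - Q.m| / 5 + |(T k).m - Q.m| / 5 := by
        have := abs_sub_le (T i).m (σ (x, Q.line x)) (T k).m
        rw [abs_sub_comm (T i).m (σ _)] at this
        linarith [hxi.2, hxk.2]
      have h2 := abs_sub_le (T i).m (T k).m Q.m
      have h3 := abs_sub_le (T k).m (T i).m Q.m
      rw [abs_sub_comm (T k).m (T i).m] at h3
      constructor <;> linarith
    refine hS.sum_crossing_le hanti H (hHG.trans hGS) (fun i hi => hGQ i (hHG hi)) ?_ hkH ?_
    · intro i hi j hj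
      linarith [(hangle i hi).1, (hangle j hj).2]
    · intro i hi
      obtain ⟨hiG, ⟨x, hxi, hxk⟩, hℓ⟩ := Finset.mem_filter.1 hi
      have h1 := abs_le.1 hxi.1
      have h2 := abs_le.1 hxk.1
      have h3 := abs_le.1 (hGQ i hiG).abs_cross_sub_le
      have h4 := abs_le.1 (hGQ k hkG).abs_cross_sub_le
      rw [abs_le]
      constructor <;> linarith [(T k).ℓ_pos]
  have hsum : ∑ i ∈ G, (T i).w / |(T i).m - Q.m| ≤ ∑ k ∈ F, 56 * (T k).ℓ := by
    rw [← Finset.sum_fiberwise_of_maps_to (t := F) (g := c)]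
    · exact Finset.sum_le_sum hgroup
    · intro i hi
      exact Finset.mem_filter.2 ⟨huG (hcu i hi), hcu i hi⟩
  have hvol : ∑ k ∈ F, 2 * δ * (T k).ℓ ≤ 8 * Q.ℓ := by
    have hQ := Q.ℓ_pos
    rw [← ENNReal.ofReal_le_ofReal_iff (by positivity),
      ENNReal.ofReal_sum_of_nonneg fun k _ => by have := (T k).ℓ_pos; positivity]
    calc ∑ k ∈ F, ENNReal.ofReal (2 * δ * (T k).ℓ) ≤ ∑ k ∈ F, volume (U k) :=
          Finset.sum_le_sum fun k hk => hUδ k (Finset.mem_filter.1 hk).1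
      _ = volume (⋃ k ∈ F, U k) := by
          rw [measure_biUnion_finset]
          · intro i hi j hj hij
            exact hdisj (Finset.mem_filter.1 hi).2 (Finset.mem_filter.1 hj).2 hij
          · exact fun k _ => hUm k
      _ ≤ volume (Metric.closedBall Q.p (4 * Q.ℓ)) := by
          refine measure_mono (Set.iUnion₂_subset fun k hk x hx => ?_)
          have hkG := (Finset.mem_filter.1 hk).1
          have h1 := abs_le.1 hx.1
          have h2 := abs_le.1 (hGQ k hkG).abs_cross_sub_le
          have h3 := abs_le.1 (hGQ k hkG).abs_cross_sub_le'
          have h4 := (hGQ k hkG).length_le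
          rw [Metric.mem_closedBall, Real.dist_eq, abs_le]
          constructor <;> linarith
      _ = ENNReal.ofReal (8 * Q.ℓ) := by
          rw [Real.volume_closedBall]; congr 1; ring
  rw [← Finset.mul_sum] at hsum hvol
  have h1 : ∑ k ∈ F, (T k).ℓ ≤ 4 * δ⁻¹ * Q.ℓ := by
    rw [mul_right_comm, ← div_eq_mul_inv, le_div_iff₀ hδ]
    linarith
  linarith

/-! ### Area and overlap of the selected tubes. -/

/-- The tubes rejected by a greedy selection lie in the set where a vertical maximal function of
the selected ones is large. -/
theorem volume_iUnion_le (hS : ∀ i, i ∉ S → ∀ z ∈ (T i).toSet, ¬ Free T (S.filter (· < i)) z) :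
    volume (⋃ i, (T i).toSet) ≤ ENNReal.ofReal (8001 * ∑ i ∈ S, (T i).area) := by
  classical
  have hnn : 0 ≤ ∑ i ∈ S, (T i).area := Finset.sum_nonneg fun i _ => (T i).area_pos.le
  have hsel : volume (⋃ i ∈ S, (T i).toSet) ≤ ENNReal.ofReal (∑ i ∈ S, (T i).area) := by
    rw [ENNReal.ofReal_sum_of_nonneg fun i _ => (T i).area_pos.le]
    refine (measure_biUnion_finset_le _ _).trans (Finset.sum_le_sum fun i _ => ?_)
    rw [volume_toSet]
  have hm : MeasurableSet (⋃ i ∈ Sᶜ, (T i).toSet) :=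
    Finset.measurableSet_biUnion _ fun i _ => (T i).measurableSet_toSet
  have hrej : volume (⋃ i ∈ Sᶜ, (T i).toSet) ≤
      ENNReal.ofReal (8000 * ∑ i ∈ S, (T i).area) := by
    rw [Measure.volume_eq_prod, Measure.prod_apply hm]
    calc ∫⁻ x, volume (Prod.mk x ⁻¹' ⋃ i ∈ Sᶜ, (T i).toSet)
        ≤ ∫⁻ x, 20 * ∑ j ∈ S, volume ((T j).dilSlice x) := by
          refine lintegral_mono fun x => ?_
          refine volume_le_of_forall_exists_interval S _
            (fun j _ => (T j).measurableSet_dilSlice x)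
            (fun j _ => (T j).volume_dilSlice_ne_top x) _ ?_
          intro y hy
          simp only [Set.mem_preimage, Set.mem_iUnion] at hy
          obtain ⟨i, hi, hz⟩ := hy
          have h := hS i (Finset.mem_compl.1 hi) _ hz
          unfold Free at h
          push Not at h
          obtain ⟨r, hr, hlt⟩ := h
          exact ⟨r, hr, hlt.trans_le
            (Finset.sum_le_sum_of_subset (Finset.filter_subset _ _))⟩
      -- The factor `20` is the weak-type constant; `400 = 20 * 20` comes from dilating both
      -- dimensions of the tubes.
      _ = 20 * ∑ j ∈ S, ENNReal.ofReal (400 * (T j).area) := by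
          rw [lintegral_const_mul _ (Finset.measurable_fun_sum _ fun j _ =>
              (T j).measurable_volume_dilSlice),
            lintegral_finsetSum _ fun j _ => (T j).measurable_volume_dilSlice]
          simp_rw [lintegral_volume_dilSlice]
      _ = _ := by
          rw [← ENNReal.ofReal_sum_of_nonneg fun i _ => by have := (T i).area_pos; positivity,
            ← ENNReal.ofReal_ofNat 20, ← ENNReal.ofReal_mul (by norm_num), ← Finset.mul_sum]
          congr 1; ring
  calc volume (⋃ i, (T i).toSet)
      ≤ volume ((⋃ i ∈ S, (T i).toSet) ∪ ⋃ i ∈ Sᶜ, (T i).toSet) := by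
        refine measure_mono (Set.iUnion_subset fun i => ?_)
        by_cases hi : i ∈ S
        · exact (Set.subset_biUnion_of_mem (u := fun i => (T i).toSet)
            (Finset.mem_coe.2 hi)).trans Set.subset_union_left
        · exact (Set.subset_biUnion_of_mem (u := fun i => (T i).toSet)
            (Finset.mem_coe.2 (Finset.mem_compl.2 hi))).trans Set.subset_union_right
    _ ≤ _ := measure_union_le _ _
    _ ≤ _ := add_le_add hsel hrej
    _ = _ := by
        rw [← ENNReal.ofReal_add hnn (by positivity)]
        congr 1; ring

open scoped Classical in
/-- The `L²` bound for the multiplicity function of a selected family. -/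
theorem Selected.sum_volume_inter_le (hS : Selected T S)
    (hanti : ∀ i j, i ≤ j → (T j).ℓ ≤ (T i).ℓ) {σ : ℝ × ℝ → ℝ}
    (hσ : Continuous σ) {K : ℝ} (hK0 : 0 ≤ K)
    (hK : ∀ x y y', |σ (x, y) - σ (x, y')| ≤ K * |y - y'|) (hKℓ : ∀ i, K * (T i).ℓ ≤ 1 / 25)
    {δ : ℝ} (hδ : 0 < δ) (hδ1 : δ ≤ 1) {V : Fin n → Set (ℝ × ℝ)}
    (hV : ∀ i, V i ⊆ (T i).toSet)
    (hVσ : ∀ i, ∀ z ∈ V i, |σ z - (T i).m| ≤ (T i).w / (T i).ℓ)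
    (hVδ : ∀ i, ENNReal.ofReal (δ * (T i).area) ≤ volume (V i)) :
    ∑ i ∈ S, ∑ j ∈ S, volume ((T i).toSet ∩ (T j).toSet) ≤
      ENNReal.ofReal (900 * δ⁻¹ * ∑ i ∈ S, (T i).area) := by
  set f : Fin n → Fin n → ℝ≥0∞ := fun i j => volume ((T i).toSet ∩ (T j).toSet) with hf
  have hfsymm : ∀ i j, f i j = f j i := fun i j => by simp only [hf, Set.inter_comm]
  have hnn : 0 ≤ ∑ i ∈ S, (T i).area := Finset.sum_nonneg fun i _ => (T i).area_pos.le
  let par : Fin n → Fin n → Prop := fun i j => j < i ∧ ((T i).toSet ∩ (T j).toSet).Nonempty ∧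
    |(T i).m - (T j).m| * (T i).ℓ ≤ 10 * (T i).w
  let tr : Fin n → Fin n → Prop := fun i j => j < i ∧ ((T i).toSet ∩ (T j).toSet).Nonempty ∧
    10 * (T i).w < |(T i).m - (T j).m| * (T i).ℓ
  have hdiag : ∑ i ∈ S, f i i ≤ ENNReal.ofReal (∑ i ∈ S, (T i).area) := by
    rw [ENNReal.ofReal_sum_of_nonneg fun i _ => (T i).area_pos.le]
    refine Finset.sum_le_sum fun i _ => ?_
    simp only [hf, Set.inter_self, volume_toSet, le_refl]
  have hpar : ∑ i ∈ S, ∑ j ∈ S with par i j, f i j ≤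
      ENNReal.ofReal (∑ i ∈ S, (T i).area) := by
    rw [ENNReal.ofReal_sum_of_nonneg fun i _ => (T i).area_pos.le]
    refine Finset.sum_le_sum fun i hi => ?_
    have hℓ := (T i).ℓ_pos
    calc ∑ j ∈ S with par i j, f i j
        ≤ ∑ j ∈ S with par i j, ENNReal.ofReal (4 * (T i).ℓ * (T j).w) :=
          Finset.sum_le_sum fun j _ => volume_inter_le_parallel _ _
      _ = ENNReal.ofReal (4 * (T i).ℓ * ∑ j ∈ S with par i j, (T j).w) := by
          rw [Finset.mul_sum, ENNReal.ofReal_sum_of_nonneg fun j _ => by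
            have := (T j).w_pos; positivity]
      _ ≤ ENNReal.ofReal (T i).area := by
          refine ENNReal.ofReal_le_ofReal ?_
          unfold area
          exact mul_le_mul_of_nonneg_left (hS.sum_width_parallel_le hanti hi) (by positivity)
  -- Unlike the nearly parallel case, the earlier tube `j` is fixed and the sum runs over later
  -- ones. The constant is `8 * 224 = 448 * 4`, with `4 * ℓ * w` the area.
  have htr : ∑ j ∈ S, ∑ i ∈ S with tr i j, f i j ≤
      ENNReal.ofReal (448 * δ⁻¹ * ∑ i ∈ S, (T i).area) := by
    rw [Finset.mul_sum, ENNReal.ofReal_sum_of_nonneg fun i _ => by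
      have := (T i).area_pos; positivity]
    refine Finset.sum_le_sum fun j hj => ?_
    have hw := (T j).w_pos
    have hT : ∀ i ∈ S.filter fun i => tr i j, Transversal (T i) (T j) := by
      intro i hi
      obtain ⟨hiS, hji, hmeet, hθ⟩ := Finset.mem_filter.1 hi
      have := hS.width_le hanti hiS hj hji hmeet
      exact ⟨hmeet, hanti j i hji.le, hθ.le, by linarith [(T i).w_pos]⟩
    have hsum := hS.sum_transversal_le hanti _ (Finset.filter_subset _ _) hT hσ hK0 hK hKℓ hδ hV
      hVσ hVδ
    calc ∑ i ∈ S with tr i j, f i j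
        ≤ ∑ i ∈ S with tr i j,
            ENNReal.ofReal (8 * (T j).w * ((T i).w / |(T i).m - (T j).m|)) :=
          Finset.sum_le_sum fun i hi => volume_inter_le_transversal (hT i hi).slope_ne
      _ = ENNReal.ofReal (8 * (T j).w * ∑ i ∈ S with tr i j,
            (T i).w / |(T i).m - (T j).m|) := by
          rw [Finset.mul_sum, ENNReal.ofReal_sum_of_nonneg fun i _ => by
            have := (T i).w_pos; positivity]
      _ ≤ ENNReal.ofReal (448 * δ⁻¹ * (T j).area) := by
          refine ENNReal.ofReal_le_ofReal ?_
          have := mul_le_mul_of_nonneg_left hsum (by positivity : 0 ≤ 8 * (T j).w)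
          unfold area
          linarith
  have hsplit : ∀ i j, f i j ≤ (if j = i then f i j else 0) + (if par i j then f i j else 0) +
      (if tr i j then f i j else 0) + (if par j i then f j i else 0) +
      (if tr j i then f j i else 0) := by
    intro i j
    by_cases hne : ((T i).toSet ∩ (T j).toSet).Nonempty
    · have hne' : ((T j).toSet ∩ (T i).toSet).Nonempty := by rwa [Set.inter_comm]
      rcases lt_trichotomy j i with h | h | h
      · rcases le_or_gt (|(T i).m - (T j).m| * (T i).ℓ) (10 * (T i).w) with hθ | hθ
        · rw [if_pos (show par i j from ⟨h, hne, hθ⟩)]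
          exact le_add_right (le_add_right (le_add_right le_add_self))
        · rw [if_pos (show tr i j from ⟨h, hne, hθ⟩)]
          exact le_add_right (le_add_right le_add_self)
      · rw [if_pos h]
        exact le_add_right (le_add_right (le_add_right le_self_add))
      · rcases le_or_gt (|(T j).m - (T i).m| * (T j).ℓ) (10 * (T j).w) with hθ | hθ
        · rw [if_pos (show par j i from ⟨h, hne', hθ⟩), hfsymm i j]
          exact le_add_right le_add_self
        · rw [if_pos (show tr j i from ⟨h, hne', hθ⟩), hfsymm i j]
          exact le_add_self
    · rw [Set.not_nonempty_iff_eq_empty] at hne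
      simp only [hf, hne, measure_empty, zero_le]
  have hpar' : ∑ i ∈ S, ∑ j ∈ S, (if par i j then f i j else 0) ≤
      ENNReal.ofReal (∑ i ∈ S, (T i).area) := by
    refine le_trans (le_of_eq ?_) hpar
    simp_rw [Finset.sum_filter]
  have htr' : ∑ i ∈ S, ∑ j ∈ S, (if tr i j then f i j else 0) ≤
      ENNReal.ofReal (448 * δ⁻¹ * ∑ i ∈ S, (T i).area) := by
    rw [Finset.sum_comm]
    refine le_trans (le_of_eq ?_) htr
    simp_rw [Finset.sum_filter]
  have hdiag' : ∑ i ∈ S, ∑ j ∈ S, (if j = i then f i j else 0) = ∑ i ∈ S, f i i := by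
    refine Finset.sum_congr rfl fun i hi => ?_
    rw [Finset.sum_ite_eq' S i (f i), if_pos hi]
  have hδi : 1 ≤ δ⁻¹ := (one_le_inv₀ hδ).2 hδ1
  calc ∑ i ∈ S, ∑ j ∈ S, f i j
      ≤ ∑ i ∈ S, ∑ j ∈ S, ((if j = i then f i j else 0) + (if par i j then f i j else 0) +
          (if tr i j then f i j else 0) + (if par j i then f j i else 0) +
          (if tr j i then f j i else 0)) :=
        Finset.sum_le_sum fun i _ => Finset.sum_le_sum fun j _ => hsplit i j
    _ ≤ ENNReal.ofReal (∑ i ∈ S, (T i).area) + ENNReal.ofReal (∑ i ∈ S, (T i).area) +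
          ENNReal.ofReal (448 * δ⁻¹ * ∑ i ∈ S, (T i).area) +
          ENNReal.ofReal (∑ i ∈ S, (T i).area) +
          ENNReal.ofReal (448 * δ⁻¹ * ∑ i ∈ S, (T i).area) := by
        simp_rw [Finset.sum_add_distrib]
        refine add_le_add (add_le_add (add_le_add (add_le_add ?_ hpar') htr') ?_) ?_
        · exact hdiag'.trans_le hdiag
        · rw [Finset.sum_comm]; exact hpar'
        · rw [Finset.sum_comm]; exact htr'
    _ ≤ _ := by
        rw [← ENNReal.ofReal_add (by positivity) (by positivity),
          ← ENNReal.ofReal_add (by positivity) (by positivity),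
          ← ENNReal.ofReal_add (by positivity) (by positivity),
          ← ENNReal.ofReal_add (by positivity) (by positivity)]
        refine ENNReal.ofReal_le_ofReal ?_
        nlinarith

theorem exists_selection (T : Fin n → Tube)
    (hanti : ∀ i j, i ≤ j → (T j).ℓ ≤ (T i).ℓ) {σ : ℝ × ℝ → ℝ}
    (hσ : Continuous σ) {K : ℝ} (hK0 : 0 ≤ K)
    (hK : ∀ x y y', |σ (x, y) - σ (x, y')| ≤ K * |y - y'|) (hKℓ : ∀ i, K * (T i).ℓ ≤ 1 / 25)
    {δ : ℝ} (hδ : 0 < δ) (hδ1 : δ ≤ 1) {V : Fin n → Set (ℝ × ℝ)}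
    (hV : ∀ i, V i ⊆ (T i).toSet)
    (hVσ : ∀ i, ∀ z ∈ V i, |σ z - (T i).m| ≤ (T i).w / (T i).ℓ)
    (hVδ : ∀ i, ENNReal.ofReal (δ * (T i).area) ≤ volume (V i)) :
    ∃ S : Finset (Fin n),
      volume (⋃ i, (T i).toSet) ≤ ENNReal.ofReal (8001 * ∑ i ∈ S, (T i).area) ∧
      ∑ i ∈ S, ∑ j ∈ S, volume ((T i).toSet ∩ (T j).toSet) ≤
        ENNReal.ofReal (900 * δ⁻¹ * ∑ i ∈ S, (T i).area) := by
  obtain ⟨S, hS⟩ := exists_greedy_selection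
    fun (i : Fin n) (F : Finset (Fin n)) => ∃ z ∈ (T i).toSet, Free T F z
  refine ⟨S, volume_iUnion_le fun i hi z hz hfree => hi ((hS i).2 ⟨z, hz, hfree⟩), ?_⟩
  exact Selected.sum_volume_inter_le (fun i hi => (hS i).1 hi) hanti hσ hK0 hK hKℓ hδ hδ1 hV hVσ hVδ

end Tube

end LipKakeya

/-! ### From rectangles to tubes: rotated coordinates and slopes. -/

noncomputable section

namespace LipKakeya

theorem plane_inner (a b : Plane) : inner ℝ a b = a 0 * b 0 + a 1 * b 1 := by
  rw [PiLp.inner_apply, Fin.sum_univ_two]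
  simp [mul_comm]

@[simp] theorem perp_zero (a : Plane) : perp a 0 = -a 1 := rfl

@[simp] theorem perp_one (a : Plane) : perp a 1 = a 0 := rfl

theorem circ_norm (u : Circ) : ‖(u : Plane)‖ = 1 := by
  simp

theorem circ_sq_add_sq (u : Circ) : (u : Plane) 0 ^ 2 + (u : Plane) 1 ^ 2 = 1 := by
  have h := real_inner_self_eq_norm_sq (u : Plane)
  rw [circ_norm, plane_inner] at h
  linarith

theorem norm_perp (u : Circ) : ‖perp u‖ = 1 := by
  have h := circ_sq_add_sq u
  have h1 : inner ℝ (perp u) (perp u) = 1 := by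
    rw [plane_inner]; simp; linarith
  rw [real_inner_self_eq_norm_sq] at h1
  nlinarith [norm_nonneg (perp (u : Plane))]

/-- The orthonormal basis `(u, perp u)`. -/
def frame (u : Circ) : OrthonormalBasis (Fin 2) ℝ Plane :=
  have hon : Orthonormal ℝ ![(u : Plane), perp u] := by
    rw [orthonormal_iff_ite]
    intro i j
    fin_cases i <;> fin_cases j <;> simp [plane_inner, norm_perp] <;> ring
  OrthonormalBasis.mk hon (by
    rw [hon.linearIndependent.span_eq_top_of_card_eq_finrank (by simp)])

/-- Coordinates with respect to `(u, perp u)`. -/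
def coords (u : Circ) : Plane ≃ᵐ ℝ × ℝ :=
  ((frame u).measurableEquiv.trans (MeasurableEquiv.toLp 2 (Fin 2 → ℝ)).symm).trans
    MeasurableEquiv.finTwoArrow

theorem coords_apply (u : Circ) (z : Plane) :
    coords u z = (inner ℝ (u : Plane) z, inner ℝ (perp u) z) := by
  have h : ∀ i, (frame u).repr z i = inner ℝ (frame u i) z := fun i =>
    (frame u).repr_apply_apply z i
  refine Prod.ext ?_ ?_
  · exact (h 0).trans (by simp [frame])
  · exact (h 1).trans (by simp [frame])

theorem measurePreserving_coords (u : Circ) : MeasurePreserving (coords u) volume volume :=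
  ((frame u).measurePreserving_measurableEquiv.trans
    (EuclideanSpace.volume_preserving_symm_measurableEquiv_toLp (Fin 2))).trans
    (volume_preserving_finTwoArrow ℝ)

theorem coords_symm_apply (u : Circ) (c : ℝ × ℝ) :
    (coords u).symm c = c.1 • (u : Plane) + c.2 • perp u := by
  rw [MeasurableEquiv.symm_apply_eq, coords_apply]
  have h := circ_sq_add_sq u
  refine Prod.ext ?_ ?_ <;> simp [plane_inner]
  · linear_combination (-c.1) * h
  · linear_combination (-c.2) * h

theorem continuous_coords_symm (u : Circ) : Continuous (coords u).symm := by
  have : ⇑(coords u).symm = fun c : ℝ × ℝ => c.1 • (u : Plane) + c.2 • perp u :=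
    funext (coords_symm_apply u)
  rw [this]
  fun_prop

theorem dist_coords_symm (u : Circ) (x y y' : ℝ) :
    dist ((coords u).symm (x, y)) ((coords u).symm (x, y')) = |y - y'| := by
  rw [coords_symm_apply, coords_symm_apply, dist_add_left, dist_eq_norm, ← sub_smul, norm_smul,
    norm_perp, mul_one, Real.norm_eq_abs]

theorem Rect.W_pos (R : Rect) : 0 < R.W := sub_pos.2 R.width_pos

theorem Rect.W_le_L (R : Rect) : R.W ≤ R.L := R.width_le_length

theorem Rect.L_pos (R : Rect) : 0 < R.L := R.W_pos.trans_le R.W_le_L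

theorem Rect.toSet_eq_preimage (R : Rect) :
    R.toSet = coords R.e ⁻¹' (Set.Icc R.a₁ R.a₂ ×ˢ Set.Icc R.b₁ R.b₂) := by
  ext z
  rw [Set.mem_preimage, coords_apply]
  rfl

theorem Rect.volume_toSet (R : Rect) : volume R.toSet = ENNReal.ofReal (R.L * R.W) := by
  rw [R.toSet_eq_preimage, (measurePreserving_coords R.e).measure_preimage_equiv,
    Measure.volume_eq_prod, Measure.prod_prod, Real.volume_Icc, Real.volume_Icc,
    ← ENNReal.ofReal_mul (show 0 ≤ R.a₂ - R.a₁ from R.L_pos.le)]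
  rfl

/-- The slope, in the frame `(u, perp u)`, of vectors not far from `u`; it is extended to a
Lipschitz function of the vector. -/
def slope (u : Circ) (a : Plane) : ℝ := inner ℝ (perp u) a / max (inner ℝ (u : Plane) a) (7 / 10)

/-- The numerator is 1-Lipschitz and bounded by `1`, and the truncated denominator is 1-Lipschitz
and at least `7 / 10`; then `10/7 + 100/49 < 7/2`. -/
theorem abs_slope_sub_le (u a b : Circ) : |slope u a - slope u b| ≤ 7 / 2 * dist a b := by
  unfold slope
  set s := inner ℝ (perp (u : Plane)) (a : Plane)
  set t := inner ℝ (perp (u : Plane)) (b : Plane)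
  set M := max (inner ℝ (u : Plane) (a : Plane)) (7 / 10) with hM
  set N := max (inner ℝ (u : Plane) (b : Plane)) (7 / 10) with hN
  have hM7 : 7 / 10 ≤ M := le_max_right _ _
  have hN7 : 7 / 10 ≤ N := le_max_right _ _
  have hd : dist a b = ‖(a : Plane) - b‖ := by rw [Subtype.dist_eq, dist_eq_norm]
  rw [hd]
  set d := ‖(a : Plane) - b‖
  have hst : |s - t| ≤ d := by
    rw [← inner_sub_right]
    refine (abs_real_inner_le_norm _ _).trans ?_
    rw [norm_perp, one_mul]
  have hMN : |M - N| ≤ d := by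
    refine (abs_max_sub_max_le_abs _ _ _).trans ?_
    rw [← inner_sub_right]
    refine (abs_real_inner_le_norm _ _).trans ?_
    rw [circ_norm, one_mul]
  have ht : |t| ≤ 1 := by
    refine (abs_real_inner_le_norm _ _).trans ?_
    rw [norm_perp, circ_norm, one_mul]
  have hd0 : 0 ≤ d := norm_nonneg _
  have hMp : 0 < M := by linarith
  have hNp : 0 < N := by linarith
  have h1 : s / M - t / N = (s - t) / M + t * (N - M) / (M * N) := by
    field_simp; ring
  have h2 : |(s - t) / M| ≤ 10 / 7 * d := by
    rw [abs_div, abs_of_pos hMp, div_le_iff₀ hMp]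
    nlinarith
  have h3 : |t * (N - M) / (M * N)| ≤ 100 / 49 * d := by
    rw [abs_div, abs_of_pos (mul_pos hMp hNp), div_le_iff₀ (mul_pos hMp hNp), abs_mul,
      abs_sub_comm]
    have h4 : 49 / 100 ≤ M * N := by nlinarith
    have h5 : |t| * |M - N| ≤ 1 * d := mul_le_mul ht hMN (abs_nonneg _) zero_le_one
    nlinarith
  rw [h1]
  exact (abs_add_le _ _).trans (by linarith)

theorem dist_le_angle (a b : Circ) :
    dist a b ≤ InnerProductGeometry.angle (a : Plane) (b : Plane) := by
  rw [Subtype.dist_eq, dist_eq_norm]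
  set θ := InnerProductGeometry.angle (a : Plane) (b : Plane)
  have hθ : 0 ≤ θ := InnerProductGeometry.angle_nonneg _ _
  refine le_of_sq_le_sq ?_ hθ
  have h1 := norm_sub_sq_real (a : Plane) (b : Plane)
  have h2 := InnerProductGeometry.cos_angle (a : Plane) (b : Plane)
  rw [circ_norm, circ_norm] at h1 h2
  have h3 := Real.one_sub_sq_div_two_le_cos (x := θ)
  simp only [mul_one, div_one] at h2
  rw [h2] at h3
  linarith

/-- A tube containing the rectangle `R`, in the frame `(u, perp u)`. -/
def Rect.tube (R : Rect) (u : Circ) : Tube where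
  p := inner ℝ (u : Plane) (R.e : Plane) * ((R.a₁ + R.a₂) / 2) -
    inner ℝ (perp u) (R.e : Plane) * ((R.b₁ + R.b₂) / 2)
  q := inner ℝ (perp u) (R.e : Plane) * ((R.a₁ + R.a₂) / 2) +
    inner ℝ (u : Plane) (R.e : Plane) * ((R.b₁ + R.b₂) / 2)
  ℓ := R.L
  w := 2 * R.W
  m := slope u R.e
  ℓ_pos := R.L_pos
  w_pos := by linarith [R.W_pos]

theorem Rect.area_tube (R : Rect) (u : Circ) : (R.tube u).area = 8 * (R.L * R.W) := by
  simp only [Tube.area, Rect.tube]; ring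

/-- With offsets `A`, `B` from the center along and across the rectangle, the horizontal offset is
`c * A - s * B`, at most `(L + W) / 2 ≤ L`, and the vertical distance to the axis is `|B| / c`, at
most `(W / 2) / (7 / 10) < 2 * W`. -/
theorem Rect.coords_mem_tube {R : Rect} {u : Circ} (hu : 7 / 10 ≤ inner ℝ (u : Plane) (R.e : Plane))
    {z : Plane} (hz : z ∈ R.toSet) : coords u z ∈ (R.tube u).toSet := by
  obtain ⟨⟨h1, h2⟩, h3, h4⟩ := hz
  rw [coords_apply, Tube.mem_toSet]
  simp only [Rect.tube, Tube.line, slope, max_eq_left hu]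
  set c := inner ℝ (u : Plane) (R.e : Plane) with hc
  set s := inner ℝ (perp u) (R.e : Plane) with hs
  set x := inner ℝ (u : Plane) z with hx
  set y := inner ℝ (perp u) z with hy
  have huu := circ_sq_add_sq u
  have hee := circ_sq_add_sq R.e
  have hcs : c ^ 2 + s ^ 2 = 1 := by
    rw [hc, hs, plane_inner, plane_inner, perp_zero, perp_one]
    linear_combination ((R.e : Plane) 0 ^ 2 + (R.e : Plane) 1 ^ 2) * huu + hee
  have hE : inner ℝ (R.e : Plane) z = c * x + s * y := by
    rw [hc, hs, hx, hy, plane_inner, plane_inner, plane_inner, plane_inner, plane_inner, perp_zero,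
      perp_one]
    linear_combination (-((R.e : Plane) 0 * z 0 + (R.e : Plane) 1 * z 1)) * huu
  have hP : inner ℝ (perp (R.e : Plane)) z = -s * x + c * y := by
    rw [hc, hs, hx, hy, plane_inner, plane_inner, plane_inner, plane_inner, plane_inner, perp_zero,
      perp_one, perp_zero, perp_one]
    linear_combination (-(-(R.e : Plane) 1 * z 0 + (R.e : Plane) 0 * z 1)) * huu
  rw [hE] at h1 h2
  rw [hP] at h3 h4
  have hc1 : |c| ≤ 1 := by rw [abs_le]; constructor <;> nlinarith
  have hs1 : |s| ≤ 1 := by rw [abs_le]; constructor <;> nlinarith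
  have hWL := R.W_le_L
  have hW := R.W_pos
  have hL : R.L = R.a₂ - R.a₁ := rfl
  have hW' : R.W = R.b₂ - R.b₁ := rfl
  set A := c * x + s * y - (R.a₁ + R.a₂) / 2 with hA
  set B := -s * x + c * y - (R.b₁ + R.b₂) / 2 with hB
  have hA' : |A| ≤ R.L / 2 := by rw [abs_le]; constructor <;> linarith
  have hB' : |B| ≤ R.W / 2 := by rw [abs_le]; constructor <;> linarith
  constructor
  · have h : x - (c * ((R.a₁ + R.a₂) / 2) - s * ((R.b₁ + R.b₂) / 2)) = c * A - s * B := by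
      rw [hA, hB]
      linear_combination (-x) * hcs
    rw [h]
    have h5 : |c * A| ≤ 1 * (R.L / 2) := by
      rw [abs_mul]; exact mul_le_mul hc1 hA' (abs_nonneg _) zero_le_one
    have h6 : |s * B| ≤ 1 * (R.W / 2) := by
      rw [abs_mul]; exact mul_le_mul hs1 hB' (abs_nonneg _) zero_le_one
    have := abs_sub (c * A) (s * B)
    linarith
  · have hcp : 0 < c := by linarith
    have h : y - (s * ((R.a₁ + R.a₂) / 2) + c * ((R.b₁ + R.b₂) / 2) + s / c *
        (x - (c * ((R.a₁ + R.a₂) / 2) - s * ((R.b₁ + R.b₂) / 2)))) = B / c := by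
      rw [hB]
      field_simp
      linear_combination (-(R.b₁ + R.b₂)) * hcs
    rw [h, abs_div, abs_of_pos hcp, div_le_iff₀ hcp]
    nlinarith

/-! ### Unions of convex sets, and duality. -/

/-- A union of convex sets with nonempty interior is the union of their interiors up to a null
set. -/
theorem volume_iUnion_diff_iUnion_interior {E : Type*} [NormedAddCommGroup E] [NormedSpace ℝ E]
    [FiniteDimensional ℝ E] [MeasurableSpace E] [BorelSpace E] (μ : Measure E)
    [μ.IsAddHaarMeasure] {ι : Type*} (C : ι → Set E) (hconv : ∀ i, Convex ℝ (C i))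
    (hint : ∀ i, (interior (C i)).Nonempty) :
    μ ((⋃ i, C i) \ ⋃ i, interior (C i)) = 0 := by
  set s := (⋃ i, interior (C i))ᶜ with hs
  have hsm : MeasurableSet s := (isOpen_iUnion fun i => isOpen_interior).measurableSet.compl
  -- Almost every point of the complement `s` of the interiors is a density point of `s`. A point of
  -- some `C i` is not: near it the convex set fills a fixed proportion of every small ball.
  have hae := (ae_restrict_iff' hsm).1 (Besicovitch.ae_tendsto_measure_inter_div μ s)
  refine measure_mono_null ?_ (ae_iff.1 hae)
  rintro x ⟨hxC, hxs⟩ himp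
  have htend := himp hxs
  obtain ⟨i, hi⟩ := Set.mem_iUnion.1 hxC
  obtain ⟨y, hy⟩ := hint i
  obtain ⟨ε, hε, hball⟩ := Metric.isOpen_iff.1 isOpen_interior y hy
  set d := Module.finrank ℝ E with hd
  set D := dist y x + ε with hD
  have hDpos : 0 < D := by positivity
  set κ := μ (Metric.ball (0 : E) 1) with hκ
  have hκ0 : κ ≠ 0 := (Metric.measure_ball_pos μ _ one_pos).ne'
  have hκt : κ ≠ ∞ := measure_ball_lt_top.ne
  have hratio : ∀ r ∈ Set.Ioo 0 D, μ (s ∩ Metric.closedBall x r) / μ (Metric.closedBall x r) ≤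
      1 - ENNReal.ofReal ((ε / D) ^ d) := by
    rintro r ⟨hr0, hrD⟩
    set t := r / D with ht
    have ht0 : 0 < t := by positivity
    have ht1 : t ≤ 1 := (div_le_one hDpos).2 hrD.le
    have htD : t * D = r := by rw [ht]; field_simp
    -- `H` is the image of `ball y ε` under the homothety of center `x` and ratio `t`; with `D =
    -- dist y x + ε` it fits inside `closedBall x r`.
    set H := Metric.ball (x + t • (y - x)) (t * ε) with hH
    have hHC : H ⊆ interior (C i) := by
      intro z hz
      have hz' : x + t⁻¹ • (z - x) ∈ Metric.ball y ε := by
        rw [Metric.mem_ball, dist_eq_norm] at hz ⊢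
        have h1 : x + t⁻¹ • (z - x) - y = t⁻¹ • (z - (x + t • (y - x))) := by
          rw [smul_sub, smul_sub, smul_add, inv_smul_smul₀ ht0.ne']
          abel
        rw [h1, norm_smul, norm_inv, Real.norm_of_nonneg ht0.le, inv_mul_lt_iff₀ ht0]
        exact hz
      have h2 := (hconv i).add_smul_sub_mem_interior hi (hball hz') ⟨ht0, ht1⟩
      simpa [smul_inv_smul₀ ht0.ne'] using h2
    have hHB : H ⊆ Metric.closedBall x r := by
      intro z hz
      rw [Metric.mem_closedBall]
      calc dist z x ≤ dist z (x + t • (y - x)) + dist (x + t • (y - x)) x := dist_triangle _ _ _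
        _ ≤ t * ε + t * dist y x := by
            refine add_le_add hz.le (le_of_eq ?_)
            rw [dist_eq_norm, add_sub_cancel_left, norm_smul, Real.norm_of_nonneg ht0.le,
              dist_eq_norm]
        _ = r := by rw [← htD, hD]; ring
    have hadd : μ (s ∩ Metric.closedBall x r) + μ H ≤ μ (Metric.closedBall x r) := by
      rw [← measure_union _ measurableSet_ball]
      · exact measure_mono (Set.union_subset Set.inter_subset_right hHB)
      · rw [Set.disjoint_left]
        rintro z ⟨hzs, -⟩ hzH
        exact hzs (Set.mem_iUnion.2 ⟨i, hHC hzH⟩)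
    have hB0 : μ (Metric.closedBall x r) ≠ 0 := (Metric.measure_closedBall_pos μ _ hr0).ne'
    have hBt : μ (Metric.closedBall x r) ≠ ∞ := measure_closedBall_lt_top.ne
    have hHeq : μ H / μ (Metric.closedBall x r) = ENNReal.ofReal ((ε / D) ^ d) := by
      rw [hH, Measure.addHaar_ball_of_pos μ _ (by positivity), Measure.addHaar_closedBall μ _ hr0.le,
        ENNReal.mul_div_mul_right _ _ hκ0 hκt, ← ENNReal.ofReal_div_of_pos (by positivity), ← div_pow,
        ← htD, mul_div_mul_left _ _ ht0.ne']
    rw [← hHeq]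
    refine ENNReal.le_sub_of_add_le_right ?_ ?_
    · rw [hHeq]; exact ENNReal.ofReal_ne_top
    · rw [← ENNReal.add_div]
      exact ENNReal.div_le_of_le_mul (by rwa [one_mul])
  have hle : (1 : ℝ≥0∞) ≤ 1 - ENNReal.ofReal ((ε / D) ^ d) :=
    le_of_tendsto htend (Filter.eventually_of_mem (Ioo_mem_nhdsGT hDpos) hratio)
  refine absurd hle (not_le.2 (ENNReal.sub_lt_self ENNReal.one_ne_top one_ne_zero ?_))
  exact (ENNReal.ofReal_pos.2 (by positivity)).ne'

/-- If finitely many sets over which `g` has mean at least `t` have multiplicity function bounded in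
`L²`, their total measure is bounded. -/
theorem sum_measure_le_of_average {α ι : Type*} [MeasurableSpace α] (μ : Measure α) (S : Finset ι)
    (A : ι → Set α) (hA : ∀ i ∈ S, MeasurableSet (A i)) (hAt : ∀ i ∈ S, μ (A i) ≠ ∞)
    {g : α → ℝ≥0∞} (hg : AEMeasurable g μ) {t B : ℝ≥0∞}
    (havg : ∀ i ∈ S, t * μ (A i) ≤ ∫⁻ x in A i, g x ∂μ)
    (hmult : ∑ i ∈ S, ∑ j ∈ S, μ (A i ∩ A j) ≤ B * ∑ i ∈ S, μ (A i)) :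
    t ^ 2 * ∑ i ∈ S, μ (A i) ≤ B * ∫⁻ x, g x ^ 2 ∂μ := by
  set X := ∑ i ∈ S, μ (A i) with hX
  have hXt : X ≠ ∞ := ENNReal.sum_ne_top.2 hAt
  by_cases hX0 : X = 0
  · simp [hX0]
  set N : α → ℝ≥0∞ := fun x => ∑ i ∈ S, (A i).indicator 1 x with hN
  have hNm : Measurable N :=
    Finset.measurable_fun_sum _ fun i hi => measurable_one.indicator (hA i hi)
  have h1 : t * X ≤ ∫⁻ x, g x * N x ∂μ := by
    calc t * X = ∑ i ∈ S, t * μ (A i) := by rw [hX, Finset.mul_sum]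
      _ ≤ ∑ i ∈ S, ∫⁻ x in A i, g x ∂μ := Finset.sum_le_sum havg
      _ = ∑ i ∈ S, ∫⁻ x, g x * (A i).indicator 1 x ∂μ := by
          refine Finset.sum_congr rfl fun i hi => ?_
          rw [← lintegral_indicator (hA i hi)]
          congr with x
          by_cases hx : x ∈ A i <;> simp [hx]
      _ = ∫⁻ x, g x * N x ∂μ := by
          rw [← lintegral_finsetSum']
          · simp_rw [hN, Finset.mul_sum]
          · exact fun i hi => hg.mul (measurable_one.indicator (hA i hi)).aemeasurable
  have h2 : ∫⁻ x, N x ^ 2 ∂μ ≤ B * X := by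
    refine le_trans (le_of_eq ?_) hmult
    have h3 : ∀ x, N x ^ 2 = ∑ i ∈ S, ∑ j ∈ S, (A i ∩ A j).indicator 1 x := by
      intro x
      rw [hN, sq, Finset.sum_mul_sum]
      refine Finset.sum_congr rfl fun i _ => Finset.sum_congr rfl fun j _ => ?_
      by_cases hi : x ∈ A i <;> by_cases hj : x ∈ A j <;> simp [hi, hj]
    simp_rw [h3]
    rw [lintegral_finsetSum]
    · refine Finset.sum_congr rfl fun i hi => ?_
      rw [lintegral_finsetSum]
      · refine Finset.sum_congr rfl fun j hj => ?_
        rw [lintegral_indicator_one ((hA i hi).inter (hA j hj))]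
      · exact fun j hj => measurable_one.indicator ((hA i hi).inter (hA j hj))
    · exact fun i hi => Finset.measurable_fun_sum _ fun j hj =>
        measurable_one.indicator ((hA i hi).inter (hA j hj))
  have h4 := ENNReal.lintegral_mul_le_Lp_mul_Lq μ Real.HolderConjugate.two_two hg hNm.aemeasurable
  have h5 : (t * X) ^ 2 ≤ (∫⁻ x, g x ^ 2 ∂μ) * ∫⁻ x, N x ^ 2 ∂μ := by
    have h6 := pow_le_pow_left' (h1.trans h4) 2
    refine h6.trans (le_of_eq ?_)
    rw [mul_pow]
    simp only [ENNReal.rpow_two]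
    congr 1 <;>
    · rw [← ENNReal.rpow_two, ← ENNReal.rpow_mul]
      norm_num
  -- Cauchy–Schwarz bounds the square of `t * X` by a multiple of `X`; since `X` is finite and
  -- nonzero, one factor cancels.
  have h7 : t ^ 2 * X * X ≤ B * (∫⁻ x, g x ^ 2 ∂μ) * X := by
    calc t ^ 2 * X * X = (t * X) ^ 2 := by ring
      _ ≤ (∫⁻ x, g x ^ 2 ∂μ) * (B * X) := h5.trans (by gcongr)
      _ = _ := by ring
  exact (ENNReal.mul_le_mul_iff_left hX0 hXt).1 h7

/-! ### Weak type bound for finitely many rectangles. -/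

theorem lipschitzWith_lipNorm {v : Plane → Circ} (hv : ∃ K : ℝ≥0, LipschitzWith K v) :
    LipschitzWith (lipNorm v) v := by
  refine LipschitzWith.of_dist_le_mul fun x y => ?_
  refine le_of_forall_pos_le_add fun ε hε => ?_
  have hd : 0 < dist x y + 1 := by positivity
  set η : ℝ≥0 := ⟨ε / (dist x y + 1), by positivity⟩ with hη
  have hηpos : 0 < η := NNReal.coe_pos.1 (show 0 < ε / (dist x y + 1) by positivity)
  obtain ⟨K, hK, hlt⟩ := exists_lt_of_csInf_lt (s := {K : ℝ≥0 | LipschitzWith K v}) hv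
    (lt_add_of_pos_right (lipNorm v) hηpos)
  have hlt' : (K : ℝ) ≤ lipNorm v + η := by exact_mod_cast hlt.le
  have hηε : (η : ℝ) * dist x y ≤ ε := by
    change ε / (dist x y + 1) * dist x y ≤ ε
    rw [div_mul_eq_mul_div, div_le_iff₀ hd]
    nlinarith
  calc dist (v x) (v y) ≤ K * dist x y := LipschitzWith.dist_le_mul hK x y
    _ ≤ (lipNorm v + η) * dist x y := by gcongr
    _ ≤ lipNorm v * dist x y + ε := by linarith

theorem Admissible.lipNorm_mul_L_le {v : Plane → Circ} {δ : ℝ} {R : Rect}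
    (h : Admissible v δ R) : (lipNorm v : ℝ) * R.L ≤ 1 / 100 := by
  rcases eq_or_ne (lipNorm v) 0 with h0 | h0
  · rw [h0]; norm_num
  have hpos : 0 < (lipNorm v : ℝ) := NNReal.coe_pos.2 (pos_iff_ne_zero.2 h0)
  have h1 := h.1
  have h2 : (100 * (lipNorm v : ℝ≥0∞))⁻¹ = ENNReal.ofReal (100 * (lipNorm v : ℝ))⁻¹ := by
    rw [ENNReal.ofReal_inv_of_pos (by positivity), ENNReal.ofReal_mul (by norm_num),
      ENNReal.ofReal_coe_nnreal, ENNReal.ofReal_ofNat]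
  rw [h2, ENNReal.ofReal_le_ofReal_iff (by positivity), le_inv_comm₀ R.L_pos (by positivity)] at h1
  rw [← one_div] at h1
  have h3 := (le_div_iff₀ R.L_pos).1 h1
  linarith

theorem Rect.measurableSet_toSet (R : Rect) : MeasurableSet R.toSet := by
  rw [R.toSet_eq_preimage]
  exact (coords R.e).measurable (measurableSet_Icc.prod measurableSet_Icc)

theorem Rect.convex_toSet (R : Rect) : Convex ℝ R.toSet :=
  ((convex_Icc R.a₁ R.a₂).linear_preimage (innerₛₗ ℝ (R.e : Plane))).inter
    ((convex_Icc R.b₁ R.b₂).linear_preimage (innerₛₗ ℝ (perp (R.e : Plane))))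

/-- The frontier of a convex set is null, so a rectangle with empty interior would have area zero.
-/
theorem Rect.interior_toSet_nonempty (R : Rect) : (interior R.toSet).Nonempty := by
  by_contra hne
  rw [Set.not_nonempty_iff_eq_empty] at hne
  have h1 : volume R.toSet ≤ 0 := by
    rw [← R.convex_toSet.addHaar_frontier volume]
    refine measure_mono ?_
    rw [frontier, hne, Set.sdiff_empty]
    exact subset_closure
  rw [R.volume_toSet, nonpos_iff_eq_zero, ENNReal.ofReal_eq_zero] at h1
  linarith [mul_pos R.L_pos R.W_pos]

variable {v : Plane → Circ} {δ : ℝ}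

/-- Selection among finitely many admissible rectangles pointing in roughly the same direction. -/
theorem exists_rect_selection (hv : LipschitzWith (lipNorm v) v) (hδ : 0 < δ) (hδ1 : δ ≤ 1)
    {n : ℕ} (R : Fin n → Rect) (hanti : ∀ i j, i ≤ j → (R j).L ≤ (R i).L)
    (hadm : ∀ i, Admissible v δ (R i)) (u : Circ)
    (hu : ∀ i, 7 / 10 ≤ inner ℝ (u : Plane) ((R i).e : Plane)) :
    ∃ S : Finset (Fin n),
      volume (⋃ i, (R i).toSet) ≤ ENNReal.ofReal 64008 * ∑ i ∈ S, volume (R i).toSet ∧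
      ∑ i ∈ S, ∑ j ∈ S, volume ((R i).toSet ∩ (R j).toSet) ≤
        ENNReal.ofReal (57600 * δ⁻¹) * ∑ i ∈ S, volume (R i).toSet := by
  set Ψ := (coords u).symm with hΨ
  have hpre : ∀ A : Set Plane, volume (Ψ ⁻¹' A) = volume A := fun A =>
    (measurePreserving_coords u).symm.measure_preimage_equiv A
  have hsub : ∀ i, Ψ ⁻¹' (R i).toSet ⊆ ((R i).tube u).toSet := by
    intro i z hz
    have := Rect.coords_mem_tube (hu i) hz
    rwa [hΨ, MeasurableEquiv.apply_symm_apply] at this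
  -- Each tube has `8` times the area of its rectangle, hence the density `δ / 8`. The other
  -- hypotheses follow from `7/2 * 1/100 < 1/25` and, as the half-aperture is `W / (2 * L)`, from
  -- `7/4 * W / L ≤ 2 * W / L`.
  obtain ⟨S, hS1, hS2⟩ := Tube.exists_selection (fun i => (R i).tube u) hanti
    (σ := fun z => slope u (v (Ψ z))) (K := 7 / 2 * lipNorm v) (δ := δ / 8)
    (V := fun i => Ψ ⁻¹' (R i).V v)
    (by
      have h1 : LipschitzWith (7 / 2) fun a : Circ => slope u a :=
        LipschitzWith.of_dist_le_mul fun a b => by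
          rw [Real.dist_eq]; exact_mod_cast abs_slope_sub_le u a b
      exact (h1.continuous.comp hv.continuous).comp (continuous_coords_symm u))
    (by positivity)
    (by
      intro x y y'
      refine (abs_slope_sub_le u _ _).trans ?_
      have := hv.dist_le_mul (Ψ (x, y)) (Ψ (x, y'))
      rw [hΨ, dist_coords_symm] at this
      rw [hΨ]
      linarith)
    (by
      intro i
      have := (hadm i).lipNorm_mul_L_le
      change 7 / 2 * (lipNorm v : ℝ) * (R i).L ≤ 1 / 25
      linarith)
    (by positivity) (by linarith)
    (fun i => (Set.preimage_mono Set.inter_subset_left).trans (hsub i))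
    (by
      intro i z hz
      have h1 : InnerProductGeometry.angle ((R i).e : Plane) (v (Ψ z) : Plane) ≤
        ((R i).W / (R i).L) / 2 := hz.2
      have h2 := (dist_le_angle (R i).e (v (Ψ z))).trans h1
      have h3 := abs_slope_sub_le u (v (Ψ z)) (R i).e
      rw [dist_comm] at h3
      change |slope u (v (Ψ z)) - slope u (R i).e| ≤ 2 * (R i).W / (R i).L
      have h4 : 0 ≤ (R i).W / (R i).L := div_nonneg (R i).W_pos.le (R i).L_pos.le
      rw [mul_div_assoc]
      linarith)
    (by
      intro i
      rw [hpre, Rect.area_tube]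
      refine le_trans (le_of_eq ?_) (hadm i).2
      rw [Rect.volume_toSet, ← ENNReal.ofReal_mul hδ.le]
      congr 1; ring)
  have hLW : ∀ i, 0 ≤ (R i).L * (R i).W := fun i => (mul_pos (R i).L_pos (R i).W_pos).le
  have hvol : ENNReal.ofReal (∑ i ∈ S, ((R i).tube u).area) =
      ENNReal.ofReal 8 * ∑ i ∈ S, volume (R i).toSet := by
    simp_rw [Rect.area_tube, Rect.volume_toSet]
    rw [← Finset.mul_sum, ENNReal.ofReal_mul (by norm_num),
      ENNReal.ofReal_sum_of_nonneg fun i _ => hLW i]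
  refine ⟨S, ?_, ?_⟩
  · calc volume (⋃ i, (R i).toSet) = volume (⋃ i, Ψ ⁻¹' (R i).toSet) := by
          rw [← Set.preimage_iUnion, hpre]
      _ ≤ _ := (measure_mono (Set.iUnion_mono hsub)).trans hS1
      _ = _ := by
          rw [ENNReal.ofReal_mul (by norm_num), hvol, ← mul_assoc,
            ← ENNReal.ofReal_mul (by norm_num)]
          norm_num
  · calc ∑ i ∈ S, ∑ j ∈ S, volume ((R i).toSet ∩ (R j).toSet)
        = ∑ i ∈ S, ∑ j ∈ S, volume (Ψ ⁻¹' (R i).toSet ∩ Ψ ⁻¹' (R j).toSet) := by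
          simp_rw [← Set.preimage_inter, hpre]
      _ ≤ _ := (Finset.sum_le_sum fun i _ => Finset.sum_le_sum fun j _ =>
          measure_mono (Set.inter_subset_inter (hsub i) (hsub j))).trans hS2
      _ = _ := by
          rw [ENNReal.ofReal_mul (by positivity), hvol, ← mul_assoc,
            ← ENNReal.ofReal_mul (by positivity)]
          congr 2
          rw [inv_div]; ring

theorem exists_antitone_enumeration (F : Finset Rect) :
    ∃ R : Fin F.card → Rect, (∀ i j, i ≤ j → (R j).L ≤ (R i).L) ∧
      ∀ Q, Q ∈ F ↔ ∃ i, R i = Q := by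
  let e : Fin F.card ≃ F := F.equivFin.symm
  let g : Fin F.card → ℝ := fun i => -(e i : Rect).L
  refine ⟨fun i => e (Tuple.sort g i), fun i j hij => ?_, fun Q => ⟨fun hQ => ?_, ?_⟩⟩
  · have := Tuple.monotone_sort g hij
    exact neg_le_neg_iff.1 this
  · refine ⟨(Tuple.sort g).symm (e.symm ⟨Q, hQ⟩), ?_⟩
    simp
  · rintro ⟨i, rfl⟩
    exact (e _).2

/-- The weak type bound for finitely many rectangles pointing in roughly the same direction. -/
theorem volume_biUnion_sector_le (hv : LipschitzWith (lipNorm v) v) (hδ : 0 < δ) (hδ1 : δ ≤ 1)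
    {f : Plane → ℂ} (hf : AEStronglyMeasurable f volume) {t : ℝ} (ht : 0 < t) (F : Finset Rect)
    (hadm : ∀ R ∈ F, Admissible v δ R)
    (havg : ∀ R ∈ F, ENNReal.ofReal t * volume R.toSet ≤ ∫⁻ y in R.toSet, ‖f y‖ₑ) (u : Circ)
    (hu : ∀ R ∈ F, 7 / 10 ≤ inner ℝ (u : Plane) (R.e : Plane)) :
    volume (⋃ R ∈ F, R.toSet) ≤
      ENNReal.ofReal (4000000000 * δ⁻¹ * (t ^ 2)⁻¹) * eLpNorm f 2 volume ^ 2 := by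
  obtain ⟨R, hanti, hR⟩ := exists_antitone_enumeration F
  have hRF : ∀ i, R i ∈ F := fun i => (hR _).2 ⟨i, rfl⟩
  obtain ⟨S, hS1, hS2⟩ := exists_rect_selection hv hδ hδ1 R hanti (fun i => hadm _ (hRF i)) u
    fun i => hu _ (hRF i)
  have hunion : ⋃ Q ∈ F, Q.toSet = ⋃ i, (R i).toSet := by
    ext z
    simp only [Set.mem_iUnion]
    constructor
    · rintro ⟨Q, hQ, hz⟩
      obtain ⟨i, rfl⟩ := (hR Q).1 hQ
      exact ⟨i, hz⟩
    · rintro ⟨i, hz⟩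
      exact ⟨R i, hRF i, hz⟩
  have hsum := sum_measure_le_of_average volume S (fun i => (R i).toSet)
    (fun i _ => (R i).measurableSet_toSet)
    (fun i _ => by rw [Rect.volume_toSet]; exact ENNReal.ofReal_ne_top) hf.enorm
    (fun i _ => havg _ (hRF i)) hS2
  have hnorm : ∫⁻ x, ‖f x‖ₑ ^ 2 = eLpNorm f 2 volume ^ 2 := by
    have := eLpNorm_nnreal_pow_eq_lintegral (f := f) (μ := volume) (p := 2) two_ne_zero
    simpa using this.symm
  rw [hnorm] at hsum
  have ht2 : 0 < t ^ 2 := by positivity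
  have hX : ∑ i ∈ S, volume (R i).toSet ≤
      ENNReal.ofReal (57600 * δ⁻¹ * (t ^ 2)⁻¹) * eLpNorm f 2 volume ^ 2 := by
    rw [ENNReal.ofReal_mul (by positivity), ENNReal.ofReal_inv_of_pos ht2, ENNReal.ofReal_pow ht.le,
      mul_right_comm, ← div_eq_mul_inv, ENNReal.le_div_iff_mul_le, mul_comm]
    · exact hsum
    · left; exact pow_ne_zero _ (ENNReal.ofReal_pos.2 ht).ne'
    · left; exact ENNReal.pow_ne_top ENNReal.ofReal_ne_top
  rw [hunion]
  refine hS1.trans ((mul_le_mul_right hX _).trans ?_)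
  rw [← mul_assoc, ← ENNReal.ofReal_mul (by norm_num)]
  -- `64008 * 57600 < 4000000000`.
  refine mul_le_mul' (ENNReal.ofReal_le_ofReal ?_) le_rfl
  have : 0 ≤ δ⁻¹ * (t ^ 2)⁻¹ := by positivity
  linarith

/-- Every direction is close to one of four fixed ones. -/
theorem exists_four_directions :
    ∃ u : Fin 4 → Circ, ∀ e : Circ, ∃ k, 7 / 10 ≤ inner ℝ (u k : Plane) (e : Plane) := by
  have hmem : ∀ a b : ℝ, a ^ 2 + b ^ 2 = 1 → (!₂[a, b] : Plane) ∈ Metric.sphere (0 : Plane) 1 := by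
    intro a b hab
    rw [mem_sphere_zero_iff_norm, EuclideanSpace.norm_eq, Fin.sum_univ_two]
    simp [hab]
  refine ⟨![⟨!₂[1, 0], hmem _ _ (by norm_num)⟩, ⟨!₂[0, 1], hmem _ _ (by norm_num)⟩,
    ⟨!₂[-1, 0], hmem _ _ (by norm_num)⟩, ⟨!₂[0, -1], hmem _ _ (by norm_num)⟩], fun e => ?_⟩
  have h := circ_sq_add_sq e
  by_contra! hcon
  have h0 := hcon 0
  have h1 := hcon 1
  have h2 := hcon 2
  have h3 := hcon 3
  simp [plane_inner] at h0 h1 h2 h3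
  nlinarith

theorem volume_biUnion_le (hv : LipschitzWith (lipNorm v) v) (hδ : 0 < δ) (hδ1 : δ ≤ 1)
    {f : Plane → ℂ} (hf : AEStronglyMeasurable f volume) {t : ℝ} (ht : 0 < t) (F : Finset Rect)
    (hadm : ∀ R ∈ F, Admissible v δ R)
    (havg : ∀ R ∈ F, ENNReal.ofReal t * volume R.toSet ≤ ∫⁻ y in R.toSet, ‖f y‖ₑ) :
    volume (⋃ R ∈ F, R.toSet) ≤
      ENNReal.ofReal (16000000000 * δ⁻¹ * (t ^ 2)⁻¹) * eLpNorm f 2 volume ^ 2 := by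
  classical
  obtain ⟨u, hu⟩ := exists_four_directions
  let G : Fin 4 → Finset Rect := fun k =>
    F.filter fun R => 7 / 10 ≤ inner ℝ (u k : Plane) (R.e : Plane)
  calc volume (⋃ R ∈ F, R.toSet) ≤ volume (⋃ k, ⋃ R ∈ G k, R.toSet) := by
        refine measure_mono (Set.iUnion₂_subset fun R hR => ?_)
        obtain ⟨k, hk⟩ := hu R.e
        refine Set.subset_iUnion_of_subset k ?_
        exact Set.subset_biUnion_of_mem (u := fun R : Rect => R.toSet)
          (Finset.mem_coe.2 (Finset.mem_filter.2 ⟨hR, hk⟩))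
    _ ≤ ∑ k, volume (⋃ R ∈ G k, R.toSet) := measure_iUnion_fintype_le _ _
    _ ≤ ∑ _k : Fin 4,
        ENNReal.ofReal (4000000000 * δ⁻¹ * (t ^ 2)⁻¹) * eLpNorm f 2 volume ^ 2 := by
        refine Finset.sum_le_sum fun k _ => ?_
        exact volume_biUnion_sector_le hv hδ hδ1 hf ht (G k)
          (fun R hR => hadm R (Finset.mem_filter.1 hR).1)
          (fun R hR => havg R (Finset.mem_filter.1 hR).1) (u k)
          fun R hR => (Finset.mem_filter.1 hR).2
    _ = _ := by
        rw [Finset.sum_const, Finset.card_univ, Fintype.card_fin, nsmul_eq_mul, ← mul_assoc]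
        congr 1
        rw [Nat.cast_ofNat, ← ENNReal.ofReal_ofNat 4, ← ENNReal.ofReal_mul (by norm_num)]
        congr 1; ring

/-! ### Measurability and passage to all rectangles. -/

/-- The admissible rectangles over which `f` has mean larger than `c`. -/
def LargeMean (v : Plane → Circ) (δ : ℝ) (f : Plane → ℂ) (c : ℝ≥0∞) : Set Rect :=
  {R | Admissible v δ R ∧ c < (volume R.toSet)⁻¹ * ∫⁻ y in R.toSet, ‖f y‖ₑ}

theorem setOf_lt_maximalFn (v : Plane → Circ) (δ : ℝ) (f : Plane → ℂ) (c : ℝ≥0∞) :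
    {x | c < maximalFn v δ f x} = ⋃ R : LargeMean v δ f c, (R : Rect).toSet := by
  ext x
  simp only [maximalFn, Set.mem_ofPred_eq, lt_iSup_iff, Set.mem_iUnion]
  constructor
  · rintro ⟨R, hR, hlt⟩
    have hx : x ∈ R.toSet := by
      by_contra hx
      rw [Set.indicator_of_notMem hx] at hlt
      exact not_lt_zero hlt
    rw [Set.indicator_of_mem hx] at hlt
    exact ⟨⟨R, hR, hlt⟩, hx⟩
  · rintro ⟨⟨R, hR, hlt⟩, hx⟩
    refine ⟨R, hR, ?_⟩
    rwa [Set.indicator_of_mem hx]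

/-- Superlevel sets are possibly uncountable unions of rectangles. Replacing rectangles by their
interiors gives an open set and loses only a null set. -/
theorem aemeasurable_maximalFn (v : Plane → Circ) (δ : ℝ) (f : Plane → ℂ) :
    AEMeasurable (maximalFn v δ f) volume := by
  refine NullMeasurable.aemeasurable (μ := volume) ?_
  refine measurable_of_Ioi (α := ℝ≥0∞) (δ := NullMeasurableSpace Plane volume) fun c => ?_
  change NullMeasurableSet {x | c < maximalFn v δ f x} volume
  rw [setOf_lt_maximalFn]
  have hnull := volume_iUnion_diff_iUnion_interior volume
    (fun R : LargeMean v δ f c => (R : Rect).toSet) (fun R => R.1.convex_toSet)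
    fun R => R.1.interior_toSet_nonempty
  have hopen : IsOpen (⋃ R : LargeMean v δ f c, interior (R : Rect).toSet) :=
    isOpen_iUnion fun _ => isOpen_interior
  have heq : (⋃ R : LargeMean v δ f c, (R : Rect).toSet) =
      (⋃ R : LargeMean v δ f c, interior (R : Rect).toSet) ∪
        ((⋃ R : LargeMean v δ f c, (R : Rect).toSet) \
          ⋃ R : LargeMean v δ f c, interior (R : Rect).toSet) :=
    (Set.union_sdiff_cancel (Set.iUnion_mono fun _ => interior_subset)).symm
  rw [heq]
  exact hopen.measurableSet.nullMeasurableSet.union_null hnull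

theorem volume_setOf_lt_maximalFn_le (hv : LipschitzWith (lipNorm v) v) (hδ : 0 < δ) (hδ1 : δ ≤ 1)
    {f : Plane → ℂ} (hf : AEStronglyMeasurable f volume) {t : ℝ} (ht : 0 < t) :
    volume {x | ENNReal.ofReal t < maximalFn v δ f x} ≤
      ENNReal.ofReal (16000000000 * δ⁻¹ * (t ^ 2)⁻¹) * eLpNorm f 2 volume ^ 2 := by
  classical
  set 𝓡 := LargeMean v δ f (ENNReal.ofReal t) with h𝓡
  rw [setOf_lt_maximalFn]
  have hnull := volume_iUnion_diff_iUnion_interior volume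
    (fun R : 𝓡 => (R : Rect).toSet) (fun R => R.1.convex_toSet)
    fun R => R.1.interior_toSet_nonempty
  have hopen : IsOpen (⋃ R : 𝓡, interior (R : Rect).toSet) := isOpen_iUnion fun _ => isOpen_interior
  have hle : volume (⋃ R : 𝓡, (R : Rect).toSet) ≤ volume (⋃ R : 𝓡, interior (R : Rect).toSet) := by
    refine measure_mono_ae (ae_le_set.2 hnull)
  refine hle.trans ?_
  -- Inner regularity: a compact subset of the open union is covered by finitely many interiors, so
  -- the finite bound applies with a constant independent of their number.
  rw [hopen.measure_eq_iSup_isCompact]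
  refine iSup₂_le fun K hK => iSup_le fun hKc => ?_
  obtain ⟨F, hF⟩ := hKc.elim_finite_subcover (fun R : 𝓡 => interior (R : Rect).toSet)
    (fun _ => isOpen_interior) hK
  have hmem : ∀ R ∈ F.image (Subtype.val : 𝓡 → Rect), R ∈ 𝓡 := by
    intro R hR
    obtain ⟨Q, -, rfl⟩ := Finset.mem_image.1 hR
    exact Q.2
  refine (measure_mono ?_).trans (volume_biUnion_le hv hδ hδ1 hf ht (F.image Subtype.val)
    (fun R hR => (hmem R hR).1) fun R hR => ?_)
  · refine hF.trans (Set.iUnion₂_subset fun R hR => interior_subset.trans ?_)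
    exact Set.subset_biUnion_of_mem (u := fun R : Rect => R.toSet)
      (Finset.mem_coe.2 (Finset.mem_image_of_mem _ hR))
  · have h1 := (hmem R hR).2.le
    rw [mul_comm, ← div_eq_mul_inv] at h1
    exact ENNReal.mul_le_of_le_div h1

end LipKakeya

end

theorem theorem1p4 :
    ∃ C : ℝ, 0 < C ∧
      ∀ v : LipKakeya.Plane → LipKakeya.Circ, (∃ K : ℝ≥0, LipschitzWith K v) →
      ∀ δ : ℝ, 0 < δ → δ < 1 →
      ∀ f : LipKakeya.Plane → ℂ, MemLp f 2 volume →
        AEMeasurable (LipKakeya.maximalFn v δ f) volume ∧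
        ∀ t : ℝ, 0 < t →
          volume {x : LipKakeya.Plane | ENNReal.ofReal t < LipKakeya.maximalFn v δ f x} ≤
            ENNReal.ofReal (C * δ⁻¹ * (t ^ 2)⁻¹) * eLpNorm f 2 volume ^ 2 := by
  refine ⟨16000000000, by norm_num, fun v hv δ hδ hδ1 f hf => ⟨?_, fun t ht => ?_⟩⟩
  · exact LipKakeya.aemeasurable_maximalFn v δ f
  · exact LipKakeya.volume_setOf_lt_maximalFn_le (LipKakeya.lipschitzWith_lipNorm hv) hδ hδ1.le
      hf.aestronglyMeasurable ht
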